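/- **Composite IG/FTR PDF and CDF.** Let $m>0$, $V_1,V_2\ge 0$, $\sigma>0$, and let $\zeta,\phi_1,\phi_2,X,Y$ be independent, with $\zeta$ gamma distributed with shape $m$ and unit mean (density $m^m u^{m-1}e^{-mu}/\Gamma(m)$), $\phi_1,\phi_2$ uniform on $[0,2\pi)$ and $X,Y\sim\mathcal N(0,\sigma^2)$. The law of $$\left|\sqrt{\zeta}\,V_1e^{j\phi_1}+\sqrt{\zeta}\,V_2e^{j\phi_2}+X+jY\right|^2$$ is the fluctuating two-ray law $\mathrm{FTR}(\bar\gamma,m,K,\Delta)$ with $$K=\frac{V_1^2+V_2^2}{2\sigma^2},\qquad \Delta=\frac{2V_1V_2}{V_1^2+V_2^2}\ \ (\Delta=0\text{ if }V_1=V_2=0),\qquad \bar\gamma=V_1^2+V_2^2+2\sigma^2 .$$ For a random variable $X\ge 0$ with density $f_X$, let $M_X^{(n)}(s)=\int_0^\infty x^n e^{xs}f_X(x)\,dx$ for real $n\ge 0$ (generalized moment generating function, GMGF). Let $\bar Z>0$ and $Z=\bar Z\,G\,V$, where $G$ and $V$ are independent, $V\sim\mathrm{FTR}(1,m,K,\Delta)$,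 and $G$ is inverse gamma with shape $\lambda>0$ and some scale $\beta>0$ (density $\frac{\beta^\lambda}{\Gamma(\lambda)}x^{-\lambda-1}e^{-\beta/x}$ on $x>0$) such that $\mathbb E[G]=1$ (hence $\lambda>1$). Then: 1. For every such real $\lambda$, the law of $Z$ has density $f_Z$ with $f_Z(z)=0$ for $z\le 0$ and, for $z>0$, $$f_Z(z)=\frac{\bar Z^{\lambda}(\lambda-1)^{\lambda}}{z^{\lambda+1}\Gamma(\lambda)}\,M_V^{(\lambda)}\!\left(\frac{(1-\lambda)\bar Z}{z}\right),$$ where the integral defining the GMGF converges. 2. If $\lambda$ is an integer, then for $z>0$ the CDF of $Z$ is $$F_Z(z)=\sum_{n=0}^{\lambda-1}\frac{\bar Z^{n}(\lambda-1)^{n}}{z^{n}\,\Gamma(n+1)}\,M_V^{(n)}\!\left(\frac{(1-\lambda)\bar Z}{z}\right).$$ 3. For every integer $n\ge 0$ and real $s\le 0$ the integral defining $M_V^{(n)}(s)$ converges and, with $D(s)=m(1+K)-(m+K-K\Delta)s$, $$M_V^{(n)}(s)=n!\,m^m(1+K-s)^{m-n-1}\sum_{l=0}^{n}\binom nl\frac{(m)_l}{l!}\,\frac{(1+K)^{l+1}K^l}{D(s)^{m+l}}\sum_{q=0}^{l}\binom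 lq(1-\Delta)^{l-q}(2\Delta)^q\,\frac{\Gamma(\frac12+q)}{\sqrt\pi\,\Gamma(q+1)}\;{}_2F_1\!\left(m+l,\tfrac12+q;q+1;\frac{2K\Delta s}{D(s)}\right).$$ Here $(m)_l$ is the Pochhammer symbol and, for $0<b<c$ and real $x<1$, ${}_2F_1(a,b;c;x)$ is the Gauss hypergeometric function (continued analytically to $x\le -1$), that is ${}_2F_1(a,b;c;x)=\frac{\Gamma(c)}{\Gamma(b)\Gamma(c-b)}\int_0^1t^{b-1}(1-t)^{c-b-1}(1-tx)^{-a}\,dt$. 4. Consequently, if $\lambda$ is an integer, $f_Z(z)$ and $F_Z(z)$ for $z>0$ are given in closed form by inserting the expression in 3 at $s=(1-\lambda)\bar Z/z$ into 1 (with $n=\lambda$) and into 2. -/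

import Mathlib

open MeasureTheory ProbabilityTheory

noncomputable section

/-! ### The Gauss hypergeometric function -/

/-- The Gauss hypergeometric function `₂F₁(a, b; c; z)` for real `0 < b < c` and real `z < 1`, given
by Euler's integral. The integral is the analytic continuation to `z < 1` of the hypergeometric
series, which converges only for `|z| < 1`; see `gaussHypergeometric_eq_series`. -/
def gaussHypergeometric (a b c z : ℝ) : ℝ :=
  Real.Gamma c / (Real.Gamma b * Real.Gamma (c - b)) *
    ∫ t in (0 : ℝ)..1, t ^ (b - 1) * (1 - t) ^ (c - b - 1) * (1 - t * z) ^ (-a)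

theorem euler_beta_integral {u v : ℝ} (hu : 0 < u) (hv : 0 < v) :
    IntegrableOn (fun t : ℝ => t ^ (u - 1) * (1 - t) ^ (v - 1)) (Set.Ioo 0 1) ∧
    ∫ t in Set.Ioo (0 : ℝ) 1, t ^ (u - 1) * (1 - t) ^ (v - 1)
      = Real.Gamma u * Real.Gamma v / Real.Gamma (u + v) := by
  have hI : Integrable (betaPDFReal u v) := by
    refine ⟨(measurable_betaPDFReal u v).aestronglyMeasurable, ?_⟩
    have h := lintegral_betaPDF_eq_one hu hv
    rw [hasFiniteIntegral_iff_ofReal]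
    · show ∫⁻ x, betaPDF u v x < ⊤
      rw [h]; exact ENNReal.one_lt_top
    · refine Filter.Eventually.of_forall fun x => ?_
      by_cases hx : 0 < x ∧ x < 1
      · exact (betaPDFReal_pos hx.1 hx.2 hu hv).le
      · simp [betaPDFReal, hx]
  have hB := beta_pos hu hv
  have hind : (fun x => beta u v * betaPDFReal u v x) =
      (Set.Ioo (0 : ℝ) 1).indicator (fun t : ℝ => t ^ (u - 1) * (1 - t) ^ (v - 1)) := by
    funext x
    by_cases hx : 0 < x ∧ x < 1
    · rw [Set.indicator_of_mem (show x ∈ Set.Ioo (0 : ℝ) 1 from hx)]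
      simp only [betaPDFReal, hx, and_self, if_true]
      field_simp
    · rw [Set.indicator_of_notMem (show x ∉ Set.Ioo (0 : ℝ) 1 from hx)]
      simp [betaPDFReal, hx]
  refine ⟨?_, ?_⟩
  · rw [← integrable_indicator_iff measurableSet_Ioo, ← hind]
    exact hI.const_mul _
  · rw [← integral_indicator measurableSet_Ioo, ← hind, integral_const_mul]
    have h1 : ∫ x, betaPDFReal u v x = 1 := by
      rw [integral_eq_lintegral_of_nonneg_ae _ hI.1]
      · show (∫⁻ x, betaPDF u v x).toReal = 1
        rw [lintegral_betaPDF_eq_one hu hv]; simp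
      · refine Filter.Eventually.of_forall fun x => ?_
        by_cases hx : 0 < x ∧ x < 1
        · exact (betaPDFReal_pos hx.1 hx.2 hu hv).le
        · simp [betaPDFReal, hx]
    rw [h1, mul_one, beta]

theorem gamma_add_nat_eq {x : ℝ} (hx : 0 < x) (n : ℕ) :
    Real.Gamma (x + n) = (ascPochhammer ℝ n).eval x * Real.Gamma x := by
  induction n with
  | zero => simp
  | succ n ih =>
    have h : x + (n + 1 : ℕ) = (x + n) + 1 := by push_cast; ring
    rw [h, Real.Gamma_add_one (by positivity), ih, ascPochhammer_succ_right]
    simp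
    ring

theorem binomial_series_hasSum (a : ℝ) {x : ℝ} (hx : |x| < 1) :
    HasSum (fun n : ℕ => ((n.factorial : ℝ)⁻¹ * (ascPochhammer ℝ n).eval a) * x ^ n)
      ((1 - x) ^ (-a)) := by
  have h := (Real.one_add_rpow_hasFPowerSeriesOnBall_zero (a := -a)).hasSum
    (y := -x) (by simpa [Metric.mem_eball, edist_zero_right, enorm_eq_nnnorm, ← NNReal.coe_lt_one]
      using hx)
  rw [binomialSeries_eq_ordinaryHypergeometricSeries (b := (1 : ℝ))
    (by intro k; have : (0 : ℝ) ≤ k := k.cast_nonneg; linarith)] at h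
  simp only [FormalMultilinearSeries.compContinuousLinearMap_apply, zero_add, neg_neg] at h
  rw [show (1 : ℝ) + -x = 1 - x by ring] at h
  have hfun : (fun n : ℕ => ((n.factorial : ℝ)⁻¹ * (ascPochhammer ℝ n).eval a) * x ^ n) =
      fun n => (ordinaryHypergeometricSeries ℝ a 1 1 n)
        ((-ContinuousLinearMap.id ℝ ℝ) ∘ fun _ => -x) := by
    funext n
    have h1 : (ascPochhammer ℝ n).eval 1 ≠ 0 := by
      rw [ascPochhammer_eval_one]; positivity
    have h2 := ordinaryHypergeometricSeries_apply_eq a (1 : ℝ) 1 x n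
    rw [mul_assoc _ _ (Polynomial.eval 1 _)⁻¹, mul_inv_cancel₀ h1, mul_one, smul_eq_mul] at h2
    rw [← h2]
    congr 1
    funext i
    simp
  rw [hfun]
  exact h

/-- On the unit interval Euler's integral is the sum of the hypergeometric series. -/
theorem gaussHypergeometric_eq_series {a b c z : ℝ} (hb : 0 < b) (hbc : b < c) (hz : |z| < 1) :
    gaussHypergeometric a b c z = ordinaryHypergeometric a b c z := by
  have hv : 0 < c - b := by linarith
  have hc : 0 < c := by linarith
  set co : ℕ → ℝ := fun n => (n.factorial : ℝ)⁻¹ * (ascPochhammer ℝ n).eval a with hco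
  set F : ℕ → ℝ → ℝ := fun n t =>
    co n * z ^ n * (t ^ (b + n - 1) * (1 - t) ^ (c - b - 1)) with hF
  have hbn : ∀ n : ℕ, 0 < b + n := fun n => by positivity
  have hint : ∀ n, Integrable (F n) (volume.restrict (Set.Ioo 0 1)) := fun n =>
    (euler_beta_integral (hbn n) hv).1.const_mul _
  have hval : ∀ n, ∫ t in Set.Ioo (0 : ℝ) 1, F n t =
      co n * z ^ n * (Real.Gamma (b + n) * Real.Gamma (c - b) / Real.Gamma (b + n + (c - b))) :=
    fun n => by
      simp only [hF]
      rw [integral_const_mul, (euler_beta_integral (hbn n) hv).2]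
  have hsumabs : Summable fun n => |co n * z ^ n| := (binomial_series_hasSum a hz).summable.abs
  have hsum : Summable fun n => ∫ t in Set.Ioo (0 : ℝ) 1, ‖F n t‖ := by
    refine Summable.of_nonneg_of_le (fun n => integral_nonneg fun t => norm_nonneg _) (fun n => ?_)
      (hsumabs.mul_right (∫ t in Set.Ioo (0 : ℝ) 1, t ^ (b - 1) * (1 - t) ^ (c - b - 1)))
    rw [← integral_const_mul]
    refine setIntegral_mono_on (hint n).norm
      ((euler_beta_integral hb hv).1.const_mul _) measurableSet_Ioo fun t ht => ?_
    have ht0 := ht.1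
    have ht1 : 0 < 1 - t := by linarith [ht.2]
    rw [hF, Real.norm_eq_abs, abs_mul]
    refine mul_le_mul_of_nonneg_left ?_ (abs_nonneg _)
    rw [abs_of_nonneg (by positivity)]
    refine mul_le_mul_of_nonneg_right ?_ (by positivity)
    exact Real.rpow_le_rpow_of_exponent_ge ht0 ht.2.le
      (by have : (0 : ℝ) ≤ n := n.cast_nonneg
          linarith)
  have key := hasSum_integral_of_summable_integral_norm hint hsum
  have hpt : ∫ t in Set.Ioo (0 : ℝ) 1, ∑' n, F n t =
      ∫ t in Set.Ioo (0 : ℝ) 1, t ^ (b - 1) * (1 - t) ^ (c - b - 1) * (1 - t * z) ^ (-a) := by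
    refine setIntegral_congr_fun measurableSet_Ioo fun t ht => ?_
    have ht0 : 0 < t := ht.1
    have htz : |t * z| < 1 := by
      rw [abs_mul, abs_of_pos ht0]
      nlinarith [abs_nonneg z, ht.2]
    have h := (binomial_series_hasSum a htz).mul_left (t ^ (b - 1) * (1 - t) ^ (c - b - 1))
    rw [← h.tsum_eq]
    refine tsum_congr fun n => ?_
    have : t ^ (b + n - 1) = t ^ (b - 1) * t ^ n := by
      rw [← Real.rpow_natCast, ← Real.rpow_add ht0]; congr 1; ring
    simp only [hF, hco, this, mul_pow]
    ring
  rw [gaussHypergeometric, intervalIntegral.integral_of_le zero_le_one,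
    integral_Ioc_eq_integral_Ioo, ← hpt, ← key.tsum_eq, ← tsum_mul_left,
    ordinaryHypergeometric_eq_tsum]
  refine tsum_congr fun n => ?_
  rw [hval, gamma_add_nat_eq hb, show b + n + (c - b) = c + n by ring, gamma_add_nat_eq hc]
  have h1 := (Real.Gamma_pos_of_pos hb).ne'
  have h2 := (Real.Gamma_pos_of_pos hv).ne'
  have h3 := (Real.Gamma_pos_of_pos hc).ne'
  have h4 := (ascPochhammer_pos n c hc).ne'
  simp only [hco, smul_eq_mul]
  field_simp

/-! ### Inverse gamma and fluctuating two-ray laws -/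

/-- The inverse gamma law with shape `lam` and scale `β`. -/
def inverseGammaMeasure (lam β : ℝ) : Measure ℝ :=
  volume.withDensity fun x => ENNReal.ofReal
    (if 0 < x then β ^ lam / Real.Gamma lam * x ^ (-lam - 1) * Real.exp (-(β / x)) else 0)

/-- The uniform law on `[0, 2π)`. -/
def uniformPhase : Measure ℝ := cond volume (Set.Ico 0 (2 * Real.pi))

/-- The complex baseband signal
`√ζ V₁ exp (j φ₁) + √ζ V₂ exp (j φ₂) + X + j Y`. -/
def twoRaySignal (V₁ V₂ ζ φ₁ φ₂ X Y : ℝ) : ℂ :=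
  (√ζ * V₁ : ℝ) * Complex.exp (φ₁ * Complex.I) + (√ζ * V₂ : ℝ) * Complex.exp (φ₂ * Complex.I)
    + X + Y * Complex.I

/-- The joint law of the independent variables `(ζ, φ₁, φ₂, X, Y)`: `ζ` is gamma distributed with
shape `m` and unit mean, `φ₁, φ₂` are uniform phases, and `X, Y` are centred Gaussian variables of
variance `σ²`. -/
def twoRayInputLaw (m σ : ℝ) : Measure (ℝ × ℝ × ℝ × ℝ × ℝ) :=
  (gammaMeasure m m).prod (uniformPhase.prod (uniformPhase.prod
    ((gaussianReal 0 (σ ^ 2).toNNReal).prod (gaussianReal 0 (σ ^ 2).toNNReal))))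

/-- The law of the instantaneous power of the two-ray signal with fluctuating specular components. -/
def twoRayPowerLaw (m V₁ V₂ σ : ℝ) : Measure ℝ :=
  (twoRayInputLaw m σ).map fun w =>
    ‖twoRaySignal V₁ V₂ w.1 w.2.1 w.2.2.1 w.2.2.2.1 w.2.2.2.2‖ ^ 2

/-- `γ ∼ FTR(γbar, m, K, Δ)`: the random variable `γ` is distributed as the power of a fluctuating
two-ray signal with amplitudes `V₁, V₂ ≥ 0` and diffuse power `2σ² > 0` that are related to the
parameters by `K = (V₁² + V₂²) / (2σ²)`, `Δ = 2 V₁ V₂ / (V₁² + V₂²)` and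
`γbar = V₁² + V₂² + 2σ²`. (If `V₁ = V₂ = 0`, then `Δ = 0`.) -/
def IsFTR {Ω : Type*} [MeasurableSpace Ω] (γ : Ω → ℝ) (P : Measure Ω) (γbar m K Δ : ℝ) : Prop :=
  0 < m ∧ ∃ V₁ V₂ σ : ℝ, 0 ≤ V₁ ∧ 0 ≤ V₂ ∧ 0 < σ ∧
    K = (V₁ ^ 2 + V₂ ^ 2) / (2 * σ ^ 2) ∧
    Δ = 2 * V₁ * V₂ / (V₁ ^ 2 + V₂ ^ 2) ∧
    γbar = V₁ ^ 2 + V₂ ^ 2 + 2 * σ ^ 2 ∧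
    HasLaw γ (twoRayPowerLaw m V₁ V₂ σ) P

/-! ### The generalized moment generating function -/

/-- The integrand `x ^ n * exp (x s) * f_X(x)` of the generalized moment generating function. -/
def gmgfIntegrand {Ω : Type*} [MeasurableSpace Ω] (X : Ω → ℝ) (P : Measure Ω) (n s x : ℝ) : ℝ :=
  x ^ n * Real.exp (x * s) * (pdf X P volume x).toReal

/-- The generalized moment generating function `M_X^{(n)}(s) = ∫₀^∞ x ^ n exp (x s) f_X(x) dx`,
of real order `n`. -/
def gmgf {Ω : Type*} [MeasurableSpace Ω] (X : Ω → ℝ) (P : Measure Ω) (n s : ℝ) : ℝ :=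
  ∫ x in Set.Ioi (0 : ℝ), gmgfIntegrand X P n s x

/-- The closed form of the generalized moment generating function, of integer order `n`, of a
variable with law `FTR(γbar, m, K, Δ)`. -/
def ftrGMGF (γbar m K Δ : ℝ) (n : ℕ) (s : ℝ) : ℝ :=
  n.factorial * m ^ m * (1 + K - γbar * s) ^ (m - n - 1) * γbar ^ n *
    ∑ l ∈ Finset.range (n + 1),
      (n.choose l : ℝ) * ((ascPochhammer ℝ l).eval m / l.factorial) *
      ((1 + K) ^ (l + 1) * K ^ l /
        (m * (1 + K) - (m + K - K * Δ) * γbar * s) ^ (m + l)) *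
      ∑ q ∈ Finset.range (l + 1),
        (l.choose q : ℝ) * (1 - Δ) ^ (l - q) * (2 * Δ) ^ q *
        (Real.Gamma (1 / 2 + q) / (√Real.pi * Real.Gamma (q + 1))) *
        gaussHypergeometric (m + l) (1 / 2 + q) (q + 1)
          (2 * K * Δ * γbar * s / (m * (1 + K) - (m + K - K * Δ) * γbar * s))

/-! ### The composite inverse gamma / fluctuating two-ray model -/

/-- The density of the composite variable at `z`, in terms of the generalized moment generating
function of the fading variable `V`. -/
def compositePDF {Ω : Type*} [MeasurableSpace Ω] (V : Ω → ℝ) (P : Measure Ω) (Zbar lam z : ℝ) : ℝ :=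
  if 0 < z then
    Zbar ^ lam * (lam - 1) ^ lam / (z ^ (lam + 1) * Real.Gamma lam) *
      gmgf V P lam ((1 - lam) * Zbar / z)
  else 0

end

/-!
Given `ζ` and the phases, the received power is a sum of two squares of independent Gaussian
variables, a noncentral chi-squared variable. Differentiating its moment generating function
`(1 - c s)⁻¹ exp (b s / (1 - c s))` shows that its generalized moments are a Laguerre polynomial in
the noncentrality times an exponential. The noncentrality is proportional to `ζ`, so averaging over
`ζ` amounts to gamma moments, and it depends on the phases only through `cos (φ₁ - φ₂)`, whose law
is that of `cos φ` for one uniform phase. After expanding `(1 - Δ + 2 Δ t) ^ l` with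
`t = (1 + cos φ) / 2`, the average over `φ` is Euler's integral for the hypergeometric function.

Given `V = v`, the product `Zbar * G * v` is inverse gamma with scale proportional to `v`. Its
density is a power of `v` times an exponential in `v`, and for integer shape its distribution
function is a Poisson sum, by the duality between gamma and Poisson tails. Averaging over `v`
turns each `v ^ n * exp (v s)` into a value of the generalized moment generating function of `V`.
-/

noncomputable section

/-- The law of the squared norm of a planar Gaussian vector with mean `(a, b)` and covariance
`v • 1`, that is, the noncentral chi-squared law with two degrees of freedom, scaled by `v`. -/
def noncentralChiSqMeasure (v : NNReal) (a b : ℝ) : Measure ℝ :=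
  ((gaussianReal a v).prod (gaussianReal b v)).map fun p => p.1 ^ 2 + p.2 ^ 2

instance (v : NNReal) (a b : ℝ) : IsProbabilityMeasure (noncentralChiSqMeasure v a b) :=
  Measure.isProbabilityMeasure_map (by fun_prop)

section NoncentralChiSq

variable {v : NNReal} {s : ℝ}

theorem gaussianPDFReal_mul_exp_mul_sq (hv : v ≠ 0) (hs : 2 * v * s < 1) (μ x : ℝ) :
    gaussianPDFReal μ v x * Real.exp (s * x ^ 2) =
      (√(2 * Real.pi * v))⁻¹ * Real.exp (s * μ ^ 2 / (1 - 2 * v * s)) *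
        Real.exp (-((1 - 2 * v * s) / (2 * v)) * (x - μ / (1 - 2 * v * s)) ^ 2) := by
  have hv' : (v : ℝ) ≠ 0 := by exact_mod_cast hv
  have hw : 1 - 2 * v * s ≠ 0 := by linarith
  rw [gaussianPDFReal, mul_assoc _⁻¹, mul_assoc _⁻¹, ← Real.exp_add, ← Real.exp_add]
  congr 2
  field_simp
  ring

theorem integral_exp_mul_sq_gaussianReal (hv : v ≠ 0) (hs : 2 * v * s < 1) (μ : ℝ) :
    ∫ x, Real.exp (s * x ^ 2) ∂gaussianReal μ v =
      (√(1 - 2 * v * s))⁻¹ * Real.exp (s * μ ^ 2 / (1 - 2 * v * s)) := by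
  have : 0 < (v : ℝ) := by positivity
  have hw : 0 < 1 - 2 * v * s := by linarith
  simp only [integral_gaussianReal_eq_integral_smul hv, smul_eq_mul,
    gaussianPDFReal_mul_exp_mul_sq hv hs]
  rw [integral_const_mul, integral_sub_right_eq_self
    (fun x => Real.exp (-((1 - 2 * v * s) / (2 * v)) * x ^ 2)), integral_gaussian,
    show Real.pi / ((1 - 2 * v * s) / (2 * v)) = (2 * Real.pi * v) / (1 - 2 * v * s) by
      field_simp, Real.sqrt_div' _ hw.le]
  field_simp

theorem integrable_exp_mul_sq_gaussianReal (hv : v ≠ 0) (hs : 2 * v * s < 1) (μ : ℝ) :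
    Integrable (fun x => Real.exp (s * x ^ 2)) (gaussianReal μ v) := by
  have : 0 < 1 - 2 * v * s := by linarith
  refine not_imp_comm.1 integral_undef ?_
  rw [integral_exp_mul_sq_gaussianReal hv hs]
  positivity

theorem integrable_exp_mul_noncentralChiSqMeasure (hv : v ≠ 0) (hs : 2 * v * s < 1) (a b : ℝ) :
    Integrable (fun x => Real.exp (s * x)) (noncentralChiSqMeasure v a b) := by
  rw [noncentralChiSqMeasure, integrable_map_measure (by fun_prop) (by fun_prop)]
  simp only [Function.comp_def, mul_add, Real.exp_add]
  exact (integrable_exp_mul_sq_gaussianReal hv hs a).mul_prod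
    (integrable_exp_mul_sq_gaussianReal hv hs b)

theorem mgf_noncentralChiSqMeasure (hv : v ≠ 0) (hs : 2 * v * s < 1) (a b : ℝ) :
    mgf id (noncentralChiSqMeasure v a b) s =
      (1 - 2 * v * s)⁻¹ * Real.exp (s * (a ^ 2 + b ^ 2) / (1 - 2 * v * s)) := by
  have hw : 0 < 1 - 2 * v * s := by linarith
  simp only [mgf, id]
  rw [noncentralChiSqMeasure, integral_map (by fun_prop) (by fun_prop)]
  simp only [mul_add, Real.exp_add, add_div]
  rw [integral_prod_mul (fun x => Real.exp (s * x ^ 2)) (fun x => Real.exp (s * x ^ 2)),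
    integral_exp_mul_sq_gaussianReal hv hs, integral_exp_mul_sq_gaussianReal hv hs,
    mul_mul_mul_comm, ← mul_inv, Real.mul_self_sqrt hw.le]

end NoncentralChiSq

/-- The Laguerre polynomial `L_n(-X)`, whose coefficients are positive. -/
def negLaguerre (n : ℕ) : Polynomial ℝ :=
  ∑ l ∈ Finset.range (n + 1), Polynomial.monomial l ((n.choose l : ℝ) / l.factorial)

theorem coeff_negLaguerre (n l : ℕ) :
    (negLaguerre n).coeff l = (n.choose l : ℝ) / l.factorial := by
  simp only [negLaguerre, Polynomial.finsetSum_coeff, Polynomial.coeff_monomial, Finset.sum_ite_eq',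
    Finset.mem_range, Order.lt_add_one_iff, ite_eq_left_iff, not_le]
  intro h
  simp [Nat.choose_eq_zero_of_lt h]

theorem eval_negLaguerre (n : ℕ) (x : ℝ) :
    (negLaguerre n).eval x =
      ∑ l ∈ Finset.range (n + 1), (n.choose l : ℝ) / l.factorial * x ^ l := by
  simp only [negLaguerre, Polynomial.eval_finsetSum, Polynomial.eval_monomial]

theorem negLaguerre_succ (n : ℕ) :
    Polynomial.C (n + 1 : ℝ) * negLaguerre (n + 1) =
      Polynomial.C (n + 1 : ℝ) * negLaguerre n + Polynomial.X * negLaguerre n +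
        Polynomial.X * (negLaguerre n).derivative := by
  ext (_ | l)
  · simp [coeff_negLaguerre]
  · have hpascal : ((n + 1).choose (l + 1) : ℝ) = n.choose l + n.choose (l + 1) := by
      exact_mod_cast Nat.choose_succ_succ n l
    have habsorb : (n + 1 : ℝ) * n.choose l = (n + 1).choose (l + 1) * (l + 1) := by
      exact_mod_cast Nat.add_one_mul_choose_eq n l
    simp only [Polynomial.coeff_add, Polynomial.coeff_C_mul, Polynomial.coeff_X_mul,
      Polynomial.coeff_derivative, coeff_negLaguerre, Nat.factorial_succ, Nat.cast_mul,
      Nat.cast_succ]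
    field_simp
    linear_combination habsorb + (n + 2 + l : ℝ) * hpascal

theorem hasDerivAt_pow_mul_exp_mul_negLaguerre (n : ℕ) (ρ w : ℝ) :
    HasDerivAt (fun w => w ^ (n + 1) * Real.exp (ρ * (w - 1)) * (negLaguerre n).eval (ρ * w))
      ((n + 1) * (w ^ n * Real.exp (ρ * (w - 1)) * (negLaguerre (n + 1)).eval (ρ * w))) w := by
  have hexp : HasDerivAt (fun w => Real.exp (ρ * (w - 1))) (Real.exp (ρ * (w - 1)) * ρ) w := by
    simpa using (((hasDerivAt_id w).sub_const 1).const_mul ρ).exp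
  have heval : HasDerivAt (fun w => (negLaguerre n).eval (ρ * w))
      ((negLaguerre n).derivative.eval (ρ * w) * ρ) w :=
    ((negLaguerre n).hasDerivAt (ρ * w)).comp w (by simpa using (hasDerivAt_id w).const_mul ρ)
  have hrec := congrArg (Polynomial.eval (ρ * w)) (negLaguerre_succ n)
  simp only [Polynomial.eval_add, Polynomial.eval_mul, Polynomial.eval_C, Polynomial.eval_X] at hrec
  refine (((hasDerivAt_pow (n + 1) w).fun_mul hexp).fun_mul heval).congr_deriv ?_
  push_cast
  linear_combination -(w ^ n * Real.exp (ρ * (w - 1))) * hrec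

/-- The generalized moment generating function `E[R ^ n * exp (s * R)]`, of integer order `n`, of
the squared norm `R` of a planar Gaussian vector whose covariance is `(c / 2) • 1` and whose mean
has squared norm `ρ * c`. -/
def noncentralChiSqGMGF (c ρ : ℝ) (n : ℕ) (s : ℝ) : ℝ :=
  n.factorial * c ^ n * ((1 - c * s)⁻¹ ^ (n + 1) * Real.exp (ρ * ((1 - c * s)⁻¹ - 1)) *
    (negLaguerre n).eval (ρ * (1 - c * s)⁻¹))

theorem hasDerivAt_noncentralChiSqGMGF {c s : ℝ} (hs : c * s < 1) (ρ : ℝ) (n : ℕ) :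
    HasDerivAt (noncentralChiSqGMGF c ρ n) (noncentralChiSqGMGF c ρ (n + 1) s) s := by
  have hw : 1 - c * s ≠ 0 := by linarith
  have hinv : HasDerivAt (fun s => (1 - c * s)⁻¹) (c * (1 - c * s)⁻¹ ^ 2) s := by
    refine ((((hasDerivAt_id' s).const_mul c).const_sub 1).fun_inv hw).congr_deriv ?_
    field_simp
  refine (((hasDerivAt_pow_mul_exp_mul_negLaguerre n ρ _).comp s hinv).const_mul
    (n.factorial * c ^ n : ℝ)).congr_deriv ?_
  rw [noncentralChiSqGMGF, Nat.factorial_succ]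
  push_cast
  ring

section NoncentralChiSq

variable {v : NNReal} {s : ℝ}

theorem mem_interior_integrableExpSet_noncentralChiSqMeasure (hv : v ≠ 0) (hs : 2 * v * s < 1)
    (a b : ℝ) : s ∈ interior (integrableExpSet id (noncentralChiSqMeasure v a b)) :=
  interior_maximal (t := {s : ℝ | 2 * v * s < 1})
    (fun _ ht => integrable_exp_mul_noncentralChiSqMeasure hv ht a b)
    (isOpen_lt (by fun_prop) (by fun_prop)) hs

theorem integral_pow_mul_exp_noncentralChiSqMeasure (hv : v ≠ 0) (hs : 2 * v * s < 1) (a b : ℝ)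
    (n : ℕ) :
    ∫ x, x ^ n * Real.exp (s * x) ∂noncentralChiSqMeasure v a b =
      noncentralChiSqGMGF (2 * v) ((a ^ 2 + b ^ 2) / (2 * v)) n s := by
  induction n generalizing s with
  | zero =>
    have hv' : (v : ℝ) ≠ 0 := by exact_mod_cast hv
    have hw : 1 - 2 * v * s ≠ 0 := by linarith
    have hexponent : s * (a ^ 2 + b ^ 2) / (1 - 2 * v * s) =
        (a ^ 2 + b ^ 2) / (2 * v) * ((1 - 2 * v * s)⁻¹ - 1) := by
      rw [inv_eq_one_div, div_sub_one hw, sub_sub_cancel]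
      field_simp
    have hmgf := mgf_noncentralChiSqMeasure hv hs a b
    rw [hexponent] at hmgf
    simpa [noncentralChiSqGMGF, negLaguerre, mgf] using hmgf
  | succ n ih =>
    refine (hasDerivAt_integral_pow_mul_exp_real (X := id)
      (mem_interior_integrableExpSet_noncentralChiSqMeasure hv hs a b) n).unique ?_
    refine (hasDerivAt_noncentralChiSqGMGF hs _ n).congr_of_eventuallyEq ?_
    have hnhds : ∀ᶠ t : ℝ in nhds s, 2 * v * t < 1 :=
      (isOpen_lt (by fun_prop) (by fun_prop)).mem_nhds hs
    filter_upwards [hnhds] with t ht using ih ht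

theorem ae_nonneg_noncentralChiSqMeasure (v : NNReal) (a b : ℝ) :
    ∀ᵐ x ∂noncentralChiSqMeasure v a b, 0 ≤ x :=
  (ae_map_iff (by fun_prop) measurableSet_Ici).2 (ae_of_all _ fun p => by positivity)

theorem lintegral_pow_mul_exp_noncentralChiSqMeasure (hv : v ≠ 0) (hs : 2 * v * s < 1) (a b : ℝ)
    (n : ℕ) :
    ∫⁻ x, ENNReal.ofReal (x ^ n * Real.exp (s * x)) ∂noncentralChiSqMeasure v a b =
      ENNReal.ofReal (noncentralChiSqGMGF (2 * v) ((a ^ 2 + b ^ 2) / (2 * v)) n s) := by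
  rw [← integral_pow_mul_exp_noncentralChiSqMeasure hv hs, ofReal_integral_eq_lintegral_ofReal]
  · exact integrable_pow_mul_exp_of_mem_interior_integrableExpSet
      (mem_interior_integrableExpSet_noncentralChiSqMeasure hv hs a b) n
  · filter_upwards [ae_nonneg_noncentralChiSqMeasure v a b] with x hx
    positivity

end NoncentralChiSq

theorem quasiMeasurePreserving_sq :
    Measure.QuasiMeasurePreserving (fun x : ℝ => x ^ 2) := by
  refine ⟨by fun_prop, Measure.AbsolutelyContinuous.mk fun N hN hN0 => ?_⟩
  rw [Measure.map_apply (by fun_prop) hN]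
  set S := Real.sqrt '' (N ∩ Set.Ioi 0)
  have hS : volume S = 0 :=
    addHaar_image_eq_zero_of_differentiableOn_of_addHaar_eq_zero volume
      (fun x hx => (Real.hasDerivAt_sqrt hx.2.ne').differentiableAt.differentiableWithinAt)
      (measure_mono_null Set.inter_subset_left hN0)
  have habs : ∀ x : ℝ, x ^ 2 ∈ N → x ≠ 0 → |x| ∈ S := fun x hx hx0 =>
    ⟨x ^ 2, ⟨hx, sq_pos_of_ne_zero hx0⟩, Real.sqrt_sq_eq_abs x⟩
  have hcover : (fun x : ℝ => x ^ 2) ⁻¹' N ⊆ {0} ∪ (S ∪ -S) := fun x hx => by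
    rcases lt_trichotomy x 0 with hneg | rfl | hpos
    · exact .inr (.inr (Set.mem_neg.2 (abs_of_neg hneg ▸ habs x hx hneg.ne)))
    · exact .inl rfl
    · exact .inr (.inl (abs_of_pos hpos ▸ habs x hx hpos.ne'))
  exact measure_mono_null hcover (measure_union_null (measure_singleton 0)
    (measure_union_null hS (by rw [Measure.measure_neg, hS])))

theorem noncentralChiSqMeasure_absolutelyContinuous {v : NNReal} (hv : v ≠ 0) (a b : ℝ) :
    noncentralChiSqMeasure v a b ≪ volume := by
  have hsum : Measure.QuasiMeasurePreserving (fun p : ℝ × ℝ => p.1 ^ 2 + p.2 ^ 2) :=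
    (quasiMeasurePreserving_add volume volume).comp
      (QuasiMeasurePreserving.prodMap quasiMeasurePreserving_sq quasiMeasurePreserving_sq)
  exact (((gaussianReal_absolutelyContinuous a hv).prod
    (gaussianReal_absolutelyContinuous b hv)).map hsum.measurable).trans hsum.absolutelyContinuous

section Gamma

variable {a r c : ℝ}

theorem gammaPDFReal_mul_pow_mul_exp {x : ℝ} (hx : 0 < x) (a r c : ℝ) (l : ℕ) :
    gammaPDFReal a r x * (x ^ l * Real.exp (-(c * x))) =
      r ^ a / Real.Gamma a * (x ^ (a + l - 1) * Real.exp (-((r + c) * x))) := by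
  rw [gammaPDFReal, if_pos hx.le, show a + l - 1 = (a - 1) + l by ring, Real.rpow_add hx,
    Real.rpow_natCast, show -((r + c) * x) = -(r * x) + -(c * x) by ring, Real.exp_add]
  ring

theorem measurable_gammaPDF (a r : ℝ) : Measurable (gammaPDF a r) :=
  (measurable_gammaPDFReal a r).ennreal_ofReal

theorem integral_gammaMeasure_eq_setIntegral (ha : 0 < a) (hr : 0 < r) (f : ℝ → ℝ) :
    ∫ x, f x ∂gammaMeasure a r = ∫ x in Set.Ioi 0, gammaPDFReal a r x * f x := by
  rw [gammaMeasure, integral_withDensity_eq_integral_toReal_smul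
    (measurable_gammaPDF a r) (by simp [gammaPDF]), ← integral_Ici_eq_integral_Ioi]
  simp only [gammaPDF, ENNReal.toReal_ofReal (gammaPDFReal_nonneg ha hr _), smul_eq_mul]
  refine (setIntegral_eq_integral_of_forall_compl_eq_zero fun x hx => ?_).symm
  rw [gammaPDFReal, if_neg (by simpa using hx), zero_mul]

theorem integral_pow_mul_exp_gammaMeasure (ha : 0 < a) (hr : 0 < r) (hrc : 0 < r + c) (l : ℕ) :
    ∫ x, x ^ l * Real.exp (-(c * x)) ∂gammaMeasure a r =
      r ^ a * (ascPochhammer ℝ l).eval a / (r + c) ^ (a + l) := by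
  rw [integral_gammaMeasure_eq_setIntegral ha hr, setIntegral_congr_fun measurableSet_Ioi
    fun x hx => gammaPDFReal_mul_pow_mul_exp hx a r c l, integral_const_mul,
    Real.integral_rpow_mul_exp_neg_mul_Ioi (by positivity) hrc, gamma_add_nat_eq ha, one_div,
    Real.inv_rpow hrc.le]
  have := (Real.Gamma_pos_of_pos ha).ne'
  field_simp

theorem integrable_pow_mul_exp_gammaMeasure (ha : 0 < a) (hr : 0 < r) (hrc : 0 < r + c) (l : ℕ) :
    Integrable (fun x => x ^ l * Real.exp (-(c * x))) (gammaMeasure a r) := by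
  refine not_imp_comm.1 integral_undef ?_
  rw [integral_pow_mul_exp_gammaMeasure ha hr hrc]
  have := ascPochhammer_pos l a ha
  positivity

theorem ae_nonneg_gammaMeasure (a r : ℝ) : ∀ᵐ x ∂gammaMeasure a r, 0 ≤ x := by
  rw [gammaMeasure, ae_withDensity_iff (measurable_gammaPDF a r)]
  exact ae_of_all _ fun x hx => not_lt.1 fun h => hx (gammaPDF_of_neg h)

end Gamma

/-- The generalized moment generating function, of integer order `n`, of a Rician shadowed power:
the average of `noncentralChiSqGMGF c (κ * ζ) n s` over a gamma variable `ζ` of shape `m` and unit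
mean. -/
def ricianShadowedGMGF (c m κ : ℝ) (n : ℕ) (s : ℝ) : ℝ :=
  n.factorial * c ^ n * (1 - c * s)⁻¹ ^ (n + 1) *
    ∑ l ∈ Finset.range (n + 1), (n.choose l : ℝ) / l.factorial * (κ * (1 - c * s)⁻¹) ^ l *
      (m ^ m * (ascPochhammer ℝ l).eval m / (m + κ * (1 - (1 - c * s)⁻¹)) ^ (m + l))

section RicianShadowed

variable {c m κ s : ℝ}

theorem noncentralChiSqGMGF_mul_eq_sum (c κ ζ : ℝ) (n : ℕ) (s : ℝ) :
    noncentralChiSqGMGF c (κ * ζ) n s = n.factorial * c ^ n * (1 - c * s)⁻¹ ^ (n + 1) *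
      ∑ l ∈ Finset.range (n + 1), (n.choose l : ℝ) / l.factorial * (κ * (1 - c * s)⁻¹) ^ l *
        (ζ ^ l * Real.exp (-(κ * (1 - (1 - c * s)⁻¹) * ζ))) := by
  rw [noncentralChiSqGMGF, eval_negLaguerre, Finset.mul_sum, Finset.mul_sum, Finset.mul_sum]
  refine Finset.sum_congr rfl fun l _ => ?_
  rw [show κ * ζ * ((1 - c * s)⁻¹ - 1) = -(κ * (1 - (1 - c * s)⁻¹) * ζ) by ring]
  ring

theorem integrable_noncentralChiSqGMGF_gammaMeasure (hm : 0 < m)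
    (h : 0 < m + κ * (1 - (1 - c * s)⁻¹)) (n : ℕ) :
    Integrable (fun ζ => noncentralChiSqGMGF c (κ * ζ) n s) (gammaMeasure m m) := by
  simp only [noncentralChiSqGMGF_mul_eq_sum]
  exact (integrable_finsetSum _ fun l _ =>
    (integrable_pow_mul_exp_gammaMeasure hm hm h l).const_mul _).const_mul _

theorem integral_noncentralChiSqGMGF_gammaMeasure (hm : 0 < m)
    (h : 0 < m + κ * (1 - (1 - c * s)⁻¹)) (n : ℕ) :
    ∫ ζ, noncentralChiSqGMGF c (κ * ζ) n s ∂gammaMeasure m m = ricianShadowedGMGF c m κ n s := by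
  simp only [noncentralChiSqGMGF_mul_eq_sum]
  rw [integral_const_mul, integral_finsetSum _ fun l _ =>
    (integrable_pow_mul_exp_gammaMeasure hm hm h l).const_mul _]
  simp only [integral_const_mul, integral_pow_mul_exp_gammaMeasure hm hm h, ricianShadowedGMGF]

theorem noncentralChiSqGMGF_nonneg {ρ : ℝ} (hc : 0 ≤ c) (hs : c * s < 1) (hρ : 0 ≤ ρ) (n : ℕ) :
    0 ≤ noncentralChiSqGMGF c ρ n s := by
  have : 0 < 1 - c * s := by linarith
  rw [noncentralChiSqGMGF, eval_negLaguerre]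
  positivity

theorem continuous_noncentralChiSqGMGF (c : ℝ) (n : ℕ) (s : ℝ) :
    Continuous fun ρ => noncentralChiSqGMGF c ρ n s := by
  simp only [noncentralChiSqGMGF, eval_negLaguerre]
  fun_prop

theorem lintegral_noncentralChiSqGMGF_gammaMeasure (hm : 0 < m) (hc : 0 ≤ c) (hκ : 0 ≤ κ)
    (hs : c * s < 1) (h : 0 < m + κ * (1 - (1 - c * s)⁻¹)) (n : ℕ) :
    ∫⁻ ζ, ENNReal.ofReal (noncentralChiSqGMGF c (κ * ζ) n s) ∂gammaMeasure m m =
      ENNReal.ofReal (ricianShadowedGMGF c m κ n s) := by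
  rw [← integral_noncentralChiSqGMGF_gammaMeasure hm h,
    ofReal_integral_eq_lintegral_ofReal (integrable_noncentralChiSqGMGF_gammaMeasure hm h n)]
  filter_upwards [ae_nonneg_gammaMeasure m m] with ζ hζ
    using noncentralChiSqGMGF_nonneg hc hs (mul_nonneg hκ hζ) n

end RicianShadowed

instance : IsProbabilityMeasure uniformPhase :=
  cond_isProbabilityMeasure_of_finite (by simp [Real.pi_pos])
    (by rw [Real.volume_Ico]; exact ENNReal.ofReal_ne_top)

theorem lintegral_uniformPhase (f : ℝ → ENNReal) :
    ∫⁻ φ, f φ ∂uniformPhase = (ENNReal.ofReal (2 * Real.pi))⁻¹ *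
      ∫⁻ φ in Set.Ioc 0 (2 * Real.pi), f φ := by
  rw [uniformPhase, ProbabilityTheory.cond, lintegral_smul_measure, Real.volume_Ico, sub_zero,
    setLIntegral_congr Ico_ae_eq_Ioc, smul_eq_mul]

theorem integral_uniformPhase (f : ℝ → ℝ) :
    ∫ φ, f φ ∂uniformPhase = (2 * Real.pi)⁻¹ * ∫ φ in (0 : ℝ)..2 * Real.pi, f φ := by
  rw [uniformPhase, ProbabilityTheory.cond, integral_smul_measure, Real.volume_Ico, sub_zero,
    integral_Ico_eq_integral_Ioc, ← intervalIntegral.integral_of_le Real.two_pi_pos.le,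
    ENNReal.toReal_inv, ENNReal.toReal_ofReal Real.two_pi_pos.le, smul_eq_mul]

theorem lintegral_const_sub_uniformPhase {f : ℝ → ENNReal}
    (hf : Function.Periodic f (2 * Real.pi)) (θ : ℝ) :
    ∫⁻ φ, f (θ - φ) ∂uniformPhase = ∫⁻ φ, f φ ∂uniformPhase := by
  have hreflect : ∫⁻ φ in Set.Ico 0 (2 * Real.pi), f (θ - φ) =
      ∫⁻ φ in Set.Ioc (θ - 2 * Real.pi) θ, f φ := by
    rw [← (Measure.measurePreserving_sub_left volume θ).setLIntegral_comp_preimage_emb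
      (MeasurableEquiv.subLeft θ).measurableEmbedding]
    simp
  have hperiod := (isAddFundamentalDomain_Ioc Real.two_pi_pos (θ - 2 * Real.pi)).setLIntegral_eq
    (isAddFundamentalDomain_Ioc Real.two_pi_pos 0) f hf.map_vadd_zmultiples
  rw [sub_add_cancel, zero_add] at hperiod
  rw [lintegral_uniformPhase, lintegral_uniformPhase, setLIntegral_congr Ico_ae_eq_Ioc.symm,
    hreflect, hperiod]

theorem integrable_uniformPhase_of_continuous {f : ℝ → ℝ} (hf : Continuous f) :
    Integrable f uniformPhase := by
  have : IntegrableOn f (Set.Ico 0 (2 * Real.pi)) :=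
    hf.integrableOn_Icc.mono_set Set.Ico_subset_Icc_self
  exact this.smul_measure (by simp [Real.pi_pos])

theorem integral_comp_cos_uniformPhase {f : ℝ → ℝ} (hf : Continuous fun φ => f (Real.cos φ)) :
    ∫ φ, f (Real.cos φ) ∂uniformPhase = Real.pi⁻¹ * ∫ φ in (0 : ℝ)..Real.pi, f (Real.cos φ) := by
  have hreflect : ∫ φ in Real.pi..2 * Real.pi, f (Real.cos φ) =
      ∫ φ in (0 : ℝ)..Real.pi, f (Real.cos φ) := by
    have h := intervalIntegral.integral_comp_sub_left (a := 0) (b := Real.pi)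
      (fun φ => f (Real.cos φ)) (2 * Real.pi)
    simp only [Real.cos_two_pi_sub, sub_zero] at h
    rw [h]
    ring_nf
  rw [integral_uniformPhase, ← intervalIntegral.integral_add_adjacent_intervals (b := Real.pi)
    (hf.intervalIntegrable _ _) (hf.intervalIntegrable _ _), hreflect]
  field_simp
  ring

theorem integral_comp_cos_eq_integral_rpow (f : ℝ → ℝ) :
    ∫ φ in (0 : ℝ)..Real.pi, f ((1 + Real.cos φ) / 2) =
      ∫ t in (0 : ℝ)..1, t ^ (1 / 2 - 1 : ℝ) * (1 - t) ^ (1 / 2 - 1 : ℝ) * f t := by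
  have haffine := intervalIntegral.mul_integral_comp_mul_sub (a := 0) (b := 1)
    (f := fun y => f ((1 + y) / 2) * √(1 - y ^ 2)⁻¹) 2 1
  norm_num only at haffine
  rw [← Polynomial.Chebyshev.integral_measureT_eq_integral_cos (f := fun y => f ((1 + y) / 2)),
    Polynomial.Chebyshev.integral_measureT, ← haffine, ← intervalIntegral.integral_const_mul]
  simp only [intervalIntegral.integral_of_le zero_le_one, integral_Ioc_eq_integral_Ioo]
  refine setIntegral_congr_fun measurableSet_Ioo fun t ht => ?_
  have ht0 : 0 ≤ t := ht.1.le
  have ht1 : 0 ≤ 1 - t := sub_nonneg.2 ht.2.le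
  have hsqrt : √(1 - (2 * t - 1) ^ 2) = 2 * √t * √(1 - t) := by
    rw [show 1 - (2 * t - 1) ^ 2 = 2 ^ 2 * t * (1 - t) by ring, Real.sqrt_mul (by positivity),
      Real.sqrt_mul (by positivity), Real.sqrt_sq zero_le_two]
  rw [Real.sqrt_inv, hsqrt, show (1 / 2 - 1 : ℝ) = -(1 / 2) by norm_num, Real.rpow_neg ht0,
    Real.rpow_neg ht1, ← Real.sqrt_eq_rpow, ← Real.sqrt_eq_rpow,
    show (1 + (2 * t - 1)) / 2 = t by ring, mul_inv, mul_inv]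
  ring

theorem half_one_add_cos_nonneg (φ : ℝ) : 0 ≤ (1 + Real.cos φ) / 2 := by
  linarith [Real.neg_one_le_cos φ]

theorem half_one_add_cos_le_one (φ : ℝ) : (1 + Real.cos φ) / 2 ≤ 1 := by
  linarith [Real.cos_le_one φ]

theorem continuous_pow_mul_rpow_cos {x : ℝ} (hx : x < 1) (a : ℝ) (q : ℕ) :
    Continuous fun φ => ((1 + Real.cos φ) / 2) ^ q * (1 - (1 + Real.cos φ) / 2 * x) ^ (-a) := by
  refine (by fun_prop : Continuous fun φ => ((1 + Real.cos φ) / 2) ^ q).mul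
    (Continuous.rpow_const (by fun_prop) fun φ => .inl (sub_ne_zero.2 (ne_of_gt ?_)))
  rcases le_total x 0 with h | h
  · exact (mul_nonpos_of_nonneg_of_nonpos (half_one_add_cos_nonneg φ) h).trans_lt one_pos
  · exact (mul_le_of_le_one_left h (half_one_add_cos_le_one φ)).trans_lt hx

theorem integrable_pow_mul_rpow_cos_uniformPhase {x : ℝ} (hx : x < 1) (a : ℝ) (q : ℕ) :
    Integrable (fun φ => ((1 + Real.cos φ) / 2) ^ q * (1 - (1 + Real.cos φ) / 2 * x) ^ (-a))
      uniformPhase :=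
  integrable_uniformPhase_of_continuous (continuous_pow_mul_rpow_cos hx a q)

theorem integral_uniformPhase_eq_gaussHypergeometric {x : ℝ} (hx : x < 1) (a : ℝ) (q : ℕ) :
    ∫ φ, ((1 + Real.cos φ) / 2) ^ q * (1 - (1 + Real.cos φ) / 2 * x) ^ (-a) ∂uniformPhase =
      Real.Gamma (1 / 2 + q) / (√Real.pi * Real.Gamma (q + 1)) *
        gaussHypergeometric a (1 / 2 + q) (q + 1) x := by
  have heuler : ∫ t in (0 : ℝ)..1, t ^ (1 / 2 - 1 : ℝ) * (1 - t) ^ (1 / 2 - 1 : ℝ) *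
        (t ^ q * (1 - t * x) ^ (-a)) =
      ∫ t in (0 : ℝ)..1, t ^ (1 / 2 + q - 1 : ℝ) * (1 - t) ^ (1 / 2 - 1 : ℝ) *
        (1 - t * x) ^ (-a) := by
    simp only [intervalIntegral.integral_of_le zero_le_one]
    refine setIntegral_congr_fun measurableSet_Ioc fun t ht => ?_
    rw [add_sub_right_comm, Real.rpow_add_natCast ht.1.ne']
    ring
  have : Real.Gamma (1 / 2 + q) ≠ 0 := (Real.Gamma_pos_of_pos (by positivity)).ne'
  have : Real.Gamma (q + 1) ≠ 0 := (Real.Gamma_pos_of_pos (by positivity)).ne'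
  rw [integral_comp_cos_uniformPhase
    (f := fun y => ((1 + y) / 2) ^ q * (1 - (1 + y) / 2 * x) ^ (-a))
    (continuous_pow_mul_rpow_cos hx a q),
    integral_comp_cos_eq_integral_rpow fun t => t ^ q * (1 - t * x) ^ (-a), heuler,
    gaussHypergeometric, show (q : ℝ) + 1 - (1 / 2 + q) = 1 / 2 by ring, Real.Gamma_one_half_eq]
  generalize (∫ t in (0 : ℝ)..1, t ^ (1 / 2 + q - 1 : ℝ) * (1 - t) ^ (1 / 2 - 1 : ℝ) *
    (1 - t * x) ^ (-a)) = I
  field_simp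
  rw [Real.sq_sqrt Real.pi_pos.le, mul_comm]

theorem map_norm_sq_add_prod_gaussianReal (z : ℂ) (v : NNReal) :
    ((gaussianReal 0 v).prod (gaussianReal 0 v)).map
      (fun p => ‖z + (p.1 + p.2 * Complex.I)‖ ^ 2) = noncentralChiSqMeasure v z.re z.im := by
  have hshift : ∀ a : ℝ, gaussianReal a v = (gaussianReal 0 v).map (a + ·) := fun a => by
    rw [gaussianReal_map_const_add, zero_add]
  rw [noncentralChiSqMeasure, hshift z.re, hshift z.im, Measure.map_prod_map _ _ (by fun_prop)
    (by fun_prop), Measure.map_map (by fun_prop) (by fun_prop)]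
  congr with p
  rw [Complex.sq_norm, Complex.normSq_apply]
  simp [sq]

section TwoRay

variable (V₁ V₂ : ℝ)

theorem twoRaySignal_eq_add (ζ φ₁ φ₂ X Y : ℝ) :
    twoRaySignal V₁ V₂ ζ φ₁ φ₂ X Y =
      twoRaySignal V₁ V₂ ζ φ₁ φ₂ 0 0 + (X + Y * Complex.I) := by
  simp only [twoRaySignal, Complex.ofReal_zero]
  ring

theorem sq_re_add_sq_im_twoRaySignal {ζ : ℝ} (hζ : 0 ≤ ζ) (φ₁ φ₂ : ℝ) :
    (twoRaySignal V₁ V₂ ζ φ₁ φ₂ 0 0).re ^ 2 + (twoRaySignal V₁ V₂ ζ φ₁ φ₂ 0 0).im ^ 2 =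
      ζ * (V₁ ^ 2 + V₂ ^ 2 + 2 * V₁ * V₂ * Real.cos (φ₁ - φ₂)) := by
  trans √ζ ^ 2 * (V₁ ^ 2 + V₂ ^ 2 + 2 * V₁ * V₂ * Real.cos (φ₁ - φ₂))
  · simp only [twoRaySignal, Complex.add_re, Complex.add_im, Complex.mul_re, Complex.mul_im,
      Complex.ofReal_re, Complex.ofReal_im, Complex.exp_ofReal_mul_I_re,
      Complex.exp_ofReal_mul_I_im, Complex.I_re, Complex.I_im, Real.cos_sub]
    linear_combination √ζ ^ 2 * V₁ ^ 2 * Real.sin_sq_add_cos_sq φ₁ +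
      √ζ ^ 2 * V₂ ^ 2 * Real.sin_sq_add_cos_sq φ₂
  · rw [Real.sq_sqrt hζ]

theorem measurable_norm_sq_twoRaySignal : Measurable fun w : ℝ × ℝ × ℝ × ℝ × ℝ =>
    ‖twoRaySignal V₁ V₂ w.1 w.2.1 w.2.2.1 w.2.2.2.1 w.2.2.2.2‖ ^ 2 := by
  unfold twoRaySignal
  fun_prop

variable {m : ℝ}

theorem lintegral_twoRayPowerLaw (hm : 0 < m) (σ : ℝ) {f : ℝ → ENNReal} (hf : Measurable f) :
    ∫⁻ x, f x ∂twoRayPowerLaw m V₁ V₂ σ =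
      ∫⁻ ζ, ∫⁻ φ₁, ∫⁻ φ₂, ∫⁻ x, f x ∂noncentralChiSqMeasure (σ ^ 2).toNNReal
        (twoRaySignal V₁ V₂ ζ φ₁ φ₂ 0 0).re (twoRaySignal V₁ V₂ ζ φ₁ φ₂ 0 0).im
        ∂uniformPhase ∂uniformPhase ∂gammaMeasure m m := by
  have := isProbabilityMeasure_gammaMeasure hm hm
  have hF := hf.comp (measurable_norm_sq_twoRaySignal V₁ V₂)
  rw [twoRayPowerLaw, twoRayInputLaw, lintegral_map hf (measurable_norm_sq_twoRaySignal V₁ V₂)]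
  refine (lintegral_prod _ hF.aemeasurable).trans (lintegral_congr fun ζ => ?_)
  have hF₁ := hF.comp (measurable_prodMk_left (x := ζ))
  refine (lintegral_prod _ hF₁.aemeasurable).trans (lintegral_congr fun φ₁ => ?_)
  have hF₂ := hF₁.comp (measurable_prodMk_left (x := φ₁))
  refine (lintegral_prod _ hF₂.aemeasurable).trans (lintegral_congr fun φ₂ => ?_)
  rw [← map_norm_sq_add_prod_gaussianReal, lintegral_map hf (by fun_prop)]
  simp only [← twoRaySignal_eq_add, Function.comp_apply]

variable {σ : ℝ}

theorem twoRayPowerLaw_absolutelyContinuous (hm : 0 < m) (hσ : σ ≠ 0) :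
    twoRayPowerLaw m V₁ V₂ σ ≪ volume := by
  have hv : (σ ^ 2).toNNReal ≠ 0 := (Real.toNNReal_pos.2 (sq_pos_of_ne_zero hσ)).ne'
  refine Measure.AbsolutelyContinuous.mk fun N hN hN0 => ?_
  rw [← lintegral_indicator_one hN,
    lintegral_twoRayPowerLaw V₁ V₂ hm σ (measurable_one.indicator hN)]
  simp only [lintegral_indicator_one hN,
    noncentralChiSqMeasure_absolutelyContinuous hv _ _ hN0, lintegral_zero]

theorem ae_pos_twoRayPowerLaw (hm : 0 < m) (hσ : σ ≠ 0) :
    ∀ᵐ x ∂twoRayPowerLaw m V₁ V₂ σ, 0 < x := by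
  have hnonneg : ∀ᵐ x ∂twoRayPowerLaw m V₁ V₂ σ, 0 ≤ x :=
    (ae_map_iff (measurable_norm_sq_twoRaySignal V₁ V₂).aemeasurable measurableSet_Ici).2
      (ae_of_all _ fun w => by positivity)
  filter_upwards [hnonneg, (twoRayPowerLaw_absolutelyContinuous V₁ V₂ hm hσ).ae_le
    (Measure.ae_ne volume 0)] with x hx hx0 using hx.lt_of_ne' hx0

end TwoRay

section TwoRayGMGF

variable {m V₁ V₂ σ s : ℝ}

/-- The Rician `K`-factor of the two-ray signal whose specular components have phase
difference `φ`. -/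
def twoRayKFactor (V₁ V₂ σ φ : ℝ) : ℝ :=
  (V₁ ^ 2 + V₂ ^ 2 + 2 * V₁ * V₂ * Real.cos φ) / (2 * σ ^ 2)

theorem twoRayKFactor_nonneg (V₁ V₂ σ φ : ℝ) : 0 ≤ twoRayKFactor V₁ V₂ σ φ := by
  have : V₁ ^ 2 + V₂ ^ 2 + 2 * V₁ * V₂ * Real.cos φ =
      (V₁ + V₂ * Real.cos φ) ^ 2 + (V₂ * Real.sin φ) ^ 2 := by
    linear_combination -(V₂ ^ 2) * Real.sin_sq_add_cos_sq φ
  rw [twoRayKFactor, this]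
  positivity

theorem lintegral_phases_pow_mul_exp (hσ : σ ≠ 0) (hs : 2 * σ ^ 2 * s < 1) {ζ : ℝ} (hζ : 0 ≤ ζ)
    (n : ℕ) :
    ∫⁻ φ₁, ∫⁻ φ₂, ∫⁻ x, ENNReal.ofReal (x ^ n * Real.exp (s * x))
        ∂noncentralChiSqMeasure (σ ^ 2).toNNReal (twoRaySignal V₁ V₂ ζ φ₁ φ₂ 0 0).re
          (twoRaySignal V₁ V₂ ζ φ₁ φ₂ 0 0).im ∂uniformPhase ∂uniformPhase =
      ∫⁻ φ, ENNReal.ofReal (noncentralChiSqGMGF (2 * σ ^ 2) (twoRayKFactor V₁ V₂ σ φ * ζ) n s)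
        ∂uniformPhase := by
  have hv : (σ ^ 2).toNNReal ≠ 0 := (Real.toNNReal_pos.2 (sq_pos_of_ne_zero hσ)).ne'
  have hv' : ((σ ^ 2).toNNReal : ℝ) = σ ^ 2 := Real.coe_toNNReal _ (sq_nonneg σ)
  have hdifference : ∀ φ₁ φ₂, ((twoRaySignal V₁ V₂ ζ φ₁ φ₂ 0 0).re ^ 2 +
      (twoRaySignal V₁ V₂ ζ φ₁ φ₂ 0 0).im ^ 2) / (2 * σ ^ 2) =
        twoRayKFactor V₁ V₂ σ (φ₁ - φ₂) * ζ := fun φ₁ φ₂ => by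
    rw [sq_re_add_sq_im_twoRaySignal V₁ V₂ hζ, twoRayKFactor]
    ring
  have hperiodic : Function.Periodic (fun φ => ENNReal.ofReal (noncentralChiSqGMGF (2 * σ ^ 2)
      (twoRayKFactor V₁ V₂ σ φ * ζ) n s)) (2 * Real.pi) := fun φ => by
    simp only [twoRayKFactor, Real.cos_add_two_pi]
  simp only [lintegral_pow_mul_exp_noncentralChiSqMeasure hv (hv' ▸ hs), hv', hdifference,
    lintegral_const_sub_uniformPhase hperiodic, lintegral_const, measure_univ, mul_one]

theorem lintegral_pow_mul_exp_twoRayPowerLaw (hm : 0 < m) (hσ : σ ≠ 0) (hs : s ≤ 0) (n : ℕ) :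
    ∫⁻ x, ENNReal.ofReal (x ^ n * Real.exp (s * x)) ∂twoRayPowerLaw m V₁ V₂ σ =
      ∫⁻ φ, ENNReal.ofReal (ricianShadowedGMGF (2 * σ ^ 2) m (twoRayKFactor V₁ V₂ σ φ) n s)
        ∂uniformPhase := by
  have := isProbabilityMeasure_gammaMeasure hm hm
  have hcs : 2 * σ ^ 2 * s ≤ 0 := mul_nonpos_of_nonneg_of_nonpos (by positivity) hs
  have hinv : (1 - 2 * σ ^ 2 * s)⁻¹ ≤ 1 := inv_le_one_of_one_le₀ (by linarith)
  have hcont : Continuous fun p : ℝ × ℝ =>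
      noncentralChiSqGMGF (2 * σ ^ 2) (twoRayKFactor V₁ V₂ σ p.2 * p.1) n s :=
    (continuous_noncentralChiSqGMGF _ n s).comp (by unfold twoRayKFactor; fun_prop)
  rw [lintegral_twoRayPowerLaw V₁ V₂ hm σ (by fun_prop), lintegral_congr_ae
    ((ae_nonneg_gammaMeasure m m).mono fun ζ hζ =>
      lintegral_phases_pow_mul_exp hσ (by linarith) hζ n),
    lintegral_lintegral_swap hcont.measurable.ennreal_ofReal.aemeasurable]
  refine lintegral_congr fun φ => lintegral_noncentralChiSqGMGF_gammaMeasure hm (by positivity)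
    (twoRayKFactor_nonneg V₁ V₂ σ φ) (by linarith) ?_ n
  exact add_pos_of_pos_of_nonneg hm
    (mul_nonneg (twoRayKFactor_nonneg V₁ V₂ σ φ) (sub_nonneg.2 hinv))

end TwoRayGMGF

/-- The denominator `D(s)` of `ftrGMGF`. -/
def ftrDenominator (γbar m K Δ s : ℝ) : ℝ := m * (1 + K) - (m + K - K * Δ) * γbar * s

/-- The double sum defining `ftrGMGF`, with `H l q` in place of the hypergeometric factors. -/
def ftrSum (γbar m K Δ : ℝ) (n : ℕ) (s : ℝ) (H : ℕ → ℕ → ℝ) : ℝ :=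
  n.factorial * m ^ m * (1 + K - γbar * s) ^ (m - n - 1) * γbar ^ n *
    ∑ l ∈ Finset.range (n + 1),
      (n.choose l : ℝ) * ((ascPochhammer ℝ l).eval m / l.factorial) *
      ((1 + K) ^ (l + 1) * K ^ l / ftrDenominator γbar m K Δ s ^ (m + l)) *
      ∑ q ∈ Finset.range (l + 1), (l.choose q : ℝ) * (1 - Δ) ^ (l - q) * (2 * Δ) ^ q * H l q

section FTRSum

variable {γbar m K Δ s : ℝ}

theorem ftrGMGF_eq_ftrSum (γbar m K Δ : ℝ) (n : ℕ) (s : ℝ) :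
    ftrGMGF γbar m K Δ n s = ftrSum γbar m K Δ n s fun l q =>
      Real.Gamma (1 / 2 + q) / (√Real.pi * Real.Gamma (q + 1)) *
        gaussHypergeometric (m + l) (1 / 2 + q) (q + 1)
          (2 * K * Δ * γbar * s / ftrDenominator γbar m K Δ s) := by
  simp only [ftrGMGF, ftrSum, ftrDenominator, mul_assoc]

variable {α : Type*} [MeasurableSpace α] {μ : Measure α} {H : ℕ → ℕ → α → ℝ}

theorem integrable_ftrSum (hH : ∀ l q, Integrable (H l q) μ) (γbar m K Δ : ℝ) (n : ℕ) (s : ℝ) :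
    Integrable (fun a => ftrSum γbar m K Δ n s fun l q => H l q a) μ :=
  (integrable_finsetSum _ fun l _ =>
    (integrable_finsetSum _ fun q _ => (hH l q).const_mul _).const_mul _).const_mul _

theorem integral_ftrSum (hH : ∀ l q, Integrable (H l q) μ) (γbar m K Δ : ℝ) (n : ℕ) (s : ℝ) :
    ∫ a, ftrSum γbar m K Δ n s (fun l q => H l q a) ∂μ =
      ftrSum γbar m K Δ n s fun l q => ∫ a, H l q a ∂μ := by
  have hinner : ∀ l, Integrable (fun a => ∑ q ∈ Finset.range (l + 1),
      (l.choose q : ℝ) * (1 - Δ) ^ (l - q) * (2 * Δ) ^ q * H l q a) μ := fun l =>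
    integrable_finsetSum _ fun q _ => (hH l q).const_mul _
  simp only [ftrSum]
  rw [integral_const_mul, integral_finsetSum _ fun l _ => (hinner l).const_mul _]
  simp only [integral_const_mul, integral_finsetSum _ fun q _ => (hH _ q).const_mul _]

theorem ftrDenominator_pos (hγ : 0 ≤ γbar) (hm : 0 < m) (hK : 0 ≤ K) (hΔ1 : Δ ≤ 1) (hs : s ≤ 0) :
    0 < ftrDenominator γbar m K Δ s := by
  have hcoeff : 0 ≤ m + K - K * Δ := by nlinarith
  have := mul_nonpos_of_nonneg_of_nonpos (mul_nonneg hcoeff hγ) hs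
  have : 0 < m * (1 + K) := by positivity
  rw [ftrDenominator]
  linarith

theorem ftrArgument_nonpos (hγ : 0 ≤ γbar) (hm : 0 < m) (hK : 0 ≤ K) (hΔ0 : 0 ≤ Δ) (hΔ1 : Δ ≤ 1)
    (hs : s ≤ 0) : 2 * K * Δ * γbar * s / ftrDenominator γbar m K Δ s ≤ 0 :=
  div_nonpos_of_nonpos_of_nonneg (mul_nonpos_of_nonneg_of_nonpos (by positivity) hs)
    (ftrDenominator_pos hγ hm hK hΔ1 hs).le

theorem sum_choose_mul_rpow (Δ τ y a : ℝ) (l : ℕ) :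
    ∑ q ∈ Finset.range (l + 1),
        (l.choose q : ℝ) * (1 - Δ) ^ (l - q) * (2 * Δ) ^ q * (τ ^ q * y ^ a) =
      (1 - Δ + 2 * Δ * τ) ^ l * y ^ a := by
  rw [add_comm (1 - Δ), add_pow, Finset.sum_mul]
  refine Finset.sum_congr rfl fun q _ => ?_
  rw [mul_pow (2 * Δ)]
  ring

theorem gamma_rate_eq_ftrDenominator (hK : 1 + K ≠ 0) (hw : 1 + K - γbar * s ≠ 0)
    (hD : ftrDenominator γbar m K Δ s ≠ 0) (τ : ℝ) :
    m + K * (1 - Δ + 2 * Δ * τ) * (1 - (1 - γbar / (1 + K) * s)⁻¹) =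
      ftrDenominator γbar m K Δ s *
        (1 - τ * (2 * K * Δ * γbar * s / ftrDenominator γbar m K Δ s)) / (1 + K - γbar * s) := by
  have hinv : 1 - γbar / (1 + K) * s = (1 + K - γbar * s) / (1 + K) := by field_simp
  have hcancel : ftrDenominator γbar m K Δ s *
      (1 - τ * (2 * K * Δ * γbar * s / ftrDenominator γbar m K Δ s)) =
        ftrDenominator γbar m K Δ s - τ * (2 * K * Δ * γbar * s) := by field_simp
  rw [hcancel, hinv, ftrDenominator]
  field_simp
  ring

theorem ricianShadowedGMGF_eq_ftrSum (hγ : 0 ≤ γbar) (hm : 0 < m) (hK : 0 ≤ K) (hΔ0 : 0 ≤ Δ)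
    (hΔ1 : Δ ≤ 1) (hs : s ≤ 0) {τ : ℝ} (hτ : 0 ≤ τ) (n : ℕ) :
    ricianShadowedGMGF (γbar / (1 + K)) m (K * (1 - Δ + 2 * Δ * τ)) n s =
      ftrSum γbar m K Δ n s fun l q => τ ^ q *
        (1 - τ * (2 * K * Δ * γbar * s / ftrDenominator γbar m K Δ s)) ^ (-(m + l)) := by
  have hD : 0 < ftrDenominator γbar m K Δ s := ftrDenominator_pos hγ hm hK hΔ1 hs
  have hK1 : 0 < 1 + K := by linarith
  have hw : 0 < 1 + K - γbar * s := by linarith [mul_nonpos_of_nonneg_of_nonpos hγ hs]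
  have hy : 0 < 1 - τ * (2 * K * Δ * γbar * s / ftrDenominator γbar m K Δ s) := by
    linarith [mul_nonpos_of_nonneg_of_nonpos hτ (ftrArgument_nonpos hγ hm hK hΔ0 hΔ1 hs)]
  have hinv : 1 - γbar / (1 + K) * s = (1 + K - γbar * s) / (1 + K) := by field_simp
  simp only [ricianShadowedGMGF, ftrSum, sum_choose_mul_rpow,
    gamma_rate_eq_ftrDenominator hK1.ne' hw.ne' hD.ne']
  rw [hinv]
  generalize 1 - τ * (2 * K * Δ * γbar * s / ftrDenominator γbar m K Δ s) = y at hy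
  generalize ftrDenominator γbar m K Δ s = D at hD
  generalize 1 + K - γbar * s = w at hw
  rw [Finset.mul_sum, Finset.mul_sum]
  refine Finset.sum_congr rfl fun l _ => ?_
  rw [Real.div_rpow (by positivity) hw.le, Real.mul_rpow hD.le hy.le, Real.rpow_neg hy.le,
    show m - n - 1 = m - (n + 1 : ℕ) by push_cast; ring, Real.rpow_sub_natCast hw.ne',
    Real.rpow_add_natCast hw.ne']
  have := Real.rpow_pos_of_pos hw m
  have := Real.rpow_pos_of_pos hy (m + l)
  have := Real.rpow_pos_of_pos hD (m + l)
  have := Nat.cast_ne_zero (R := ℝ).2 l.factorial_ne_zero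
  simp only [inv_div, div_pow, mul_pow]
  field_simp
  ring

end FTRSum

theorem ricianShadowedGMGF_nonneg {c m κ s : ℝ} (hm : 0 < m) (hc : 0 ≤ c) (hκ : 0 ≤ κ)
    (hs : s ≤ 0) (n : ℕ) : 0 ≤ ricianShadowedGMGF c m κ n s := by
  have hcs : c * s ≤ 0 := mul_nonpos_of_nonneg_of_nonpos hc hs
  have hw : 0 < 1 - c * s := by linarith
  have hinv : 0 ≤ 1 - (1 - c * s)⁻¹ := sub_nonneg.2 (inv_le_one_of_one_le₀ (by linarith))
  have hpoch := fun l => (ascPochhammer_pos l m hm).le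
  exact mul_nonneg (by positivity) (Finset.sum_nonneg fun l _ => mul_nonneg (by positivity)
    (div_nonneg (mul_nonneg (by positivity) (hpoch l)) (by positivity)))

section PhaseAverage

variable {γbar m K Δ s : ℝ}

theorem integrable_ricianShadowedGMGF_uniformPhase (hγ : 0 ≤ γbar) (hm : 0 < m) (hK : 0 ≤ K)
    (hΔ0 : 0 ≤ Δ) (hΔ1 : Δ ≤ 1) (hs : s ≤ 0) (n : ℕ) :
    Integrable (fun φ => ricianShadowedGMGF (γbar / (1 + K)) m
      (K * (1 - Δ + 2 * Δ * ((1 + Real.cos φ) / 2))) n s) uniformPhase := by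
  have hx := (ftrArgument_nonpos hγ hm hK hΔ0 hΔ1 hs).trans_lt one_pos
  simp only [ricianShadowedGMGF_eq_ftrSum hγ hm hK hΔ0 hΔ1 hs (half_one_add_cos_nonneg _)]
  exact integrable_ftrSum (fun l q => integrable_pow_mul_rpow_cos_uniformPhase hx (m + l) q) ..

theorem integral_ricianShadowedGMGF_uniformPhase (hγ : 0 ≤ γbar) (hm : 0 < m) (hK : 0 ≤ K)
    (hΔ0 : 0 ≤ Δ) (hΔ1 : Δ ≤ 1) (hs : s ≤ 0) (n : ℕ) :
    ∫ φ, ricianShadowedGMGF (γbar / (1 + K)) m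
        (K * (1 - Δ + 2 * Δ * ((1 + Real.cos φ) / 2))) n s ∂uniformPhase =
      ftrGMGF γbar m K Δ n s := by
  have hx := (ftrArgument_nonpos hγ hm hK hΔ0 hΔ1 hs).trans_lt one_pos
  simp only [ricianShadowedGMGF_eq_ftrSum hγ hm hK hΔ0 hΔ1 hs (half_one_add_cos_nonneg _)]
  rw [integral_ftrSum fun l q => integrable_pow_mul_rpow_cos_uniformPhase hx (m + l) q,
    ftrGMGF_eq_ftrSum]
  simp only [integral_uniformPhase_eq_gaussHypergeometric hx]

theorem ricianShadowedGMGF_phase_nonneg (hγ : 0 ≤ γbar) (hm : 0 < m) (hK : 0 ≤ K)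
    (hΔ0 : 0 ≤ Δ) (hΔ1 : Δ ≤ 1) (hs : s ≤ 0) (n : ℕ) (φ : ℝ) :
    0 ≤ ricianShadowedGMGF (γbar / (1 + K)) m
      (K * (1 - Δ + 2 * Δ * ((1 + Real.cos φ) / 2))) n s :=
  ricianShadowedGMGF_nonneg hm (by positivity) (mul_nonneg hK (add_nonneg (sub_nonneg.2 hΔ1)
    (mul_nonneg (by positivity) (half_one_add_cos_nonneg φ)))) hs n

theorem lintegral_ricianShadowedGMGF_uniformPhase (hγ : 0 ≤ γbar) (hm : 0 < m) (hK : 0 ≤ K)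
    (hΔ0 : 0 ≤ Δ) (hΔ1 : Δ ≤ 1) (hs : s ≤ 0) (n : ℕ) :
    ∫⁻ φ, ENNReal.ofReal (ricianShadowedGMGF (γbar / (1 + K)) m
        (K * (1 - Δ + 2 * Δ * ((1 + Real.cos φ) / 2))) n s) ∂uniformPhase =
      ENNReal.ofReal (ftrGMGF γbar m K Δ n s) := by
  rw [← integral_ricianShadowedGMGF_uniformPhase hγ hm hK hΔ0 hΔ1 hs,
    ofReal_integral_eq_lintegral_ofReal
      (integrable_ricianShadowedGMGF_uniformPhase hγ hm hK hΔ0 hΔ1 hs n)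
      (ae_of_all _ (ricianShadowedGMGF_phase_nonneg hγ hm hK hΔ0 hΔ1 hs n))]

theorem ftrGMGF_nonneg (hγ : 0 ≤ γbar) (hm : 0 < m) (hK : 0 ≤ K)
    (hΔ0 : 0 ≤ Δ) (hΔ1 : Δ ≤ 1) (hs : s ≤ 0) (n : ℕ) : 0 ≤ ftrGMGF γbar m K Δ n s := by
  rw [← integral_ricianShadowedGMGF_uniformPhase hγ hm hK hΔ0 hΔ1 hs]
  exact integral_nonneg (ricianShadowedGMGF_phase_nonneg hγ hm hK hΔ0 hΔ1 hs n)

end PhaseAverage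

theorem twoRayKFactor_eq (V₁ V₂ σ φ : ℝ) :
    twoRayKFactor V₁ V₂ σ φ = (V₁ ^ 2 + V₂ ^ 2) / (2 * σ ^ 2) *
      (1 - 2 * V₁ * V₂ / (V₁ ^ 2 + V₂ ^ 2) +
        2 * (2 * V₁ * V₂ / (V₁ ^ 2 + V₂ ^ 2)) * ((1 + Real.cos φ) / 2)) := by
  rw [twoRayKFactor]
  rcases eq_or_ne (V₁ ^ 2 + V₂ ^ 2) 0 with h | h
  · have hV₁ : V₁ = 0 := by nlinarith [sq_nonneg V₁, sq_nonneg V₂]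
    simp [hV₁]
  · field_simp
    ring

namespace IsFTR

variable {Ω : Type*} [MeasurableSpace Ω] {P : Measure Ω} {V : Ω → ℝ} {γbar m K Δ : ℝ}

theorem shape_pos (hV : IsFTR V P γbar m K Δ) : 0 < m := hV.1

theorem meanPower_nonneg (hV : IsFTR V P γbar m K Δ) : 0 ≤ γbar := by
  obtain ⟨-, V₁, V₂, σ, -, -, -, -, -, rfl, -⟩ := hV
  positivity

theorem kFactor_nonneg (hV : IsFTR V P γbar m K Δ) : 0 ≤ K := by
  obtain ⟨-, V₁, V₂, σ, -, -, -, rfl, -⟩ := hV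
  positivity

theorem delta_nonneg (hV : IsFTR V P γbar m K Δ) : 0 ≤ Δ := by
  obtain ⟨-, V₁, V₂, σ, hV₁, hV₂, -, -, rfl, -⟩ := hV
  positivity

theorem delta_le_one (hV : IsFTR V P γbar m K Δ) : Δ ≤ 1 := by
  obtain ⟨-, V₁, V₂, σ, -, -, -, -, rfl, -⟩ := hV
  exact div_le_one_of_le₀ (two_mul_le_add_sq V₁ V₂) (by positivity)

theorem aemeasurable (hV : IsFTR V P γbar m K Δ) : AEMeasurable V P := by
  obtain ⟨-, _, _, _, -, -, -, -, -, -, hlaw⟩ := hV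
  exact hlaw.aemeasurable

theorem map_absolutelyContinuous (hV : IsFTR V P γbar m K Δ) : P.map V ≪ volume := by
  obtain ⟨hm, V₁, V₂, σ, -, -, hσ, -, -, -, hlaw⟩ := hV
  exact hlaw.map_eq ▸ twoRayPowerLaw_absolutelyContinuous V₁ V₂ hm hσ.ne'

theorem ae_map_pos (hV : IsFTR V P γbar m K Δ) : ∀ᵐ v ∂P.map V, 0 < v := by
  obtain ⟨hm, V₁, V₂, σ, -, -, hσ, -, -, -, hlaw⟩ := hV
  exact hlaw.map_eq ▸ ae_pos_twoRayPowerLaw V₁ V₂ hm hσ.ne'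

theorem lintegral_map_pow_mul_exp (hV : IsFTR V P γbar m K Δ) {s : ℝ} (hs : s ≤ 0) (n : ℕ) :
    ∫⁻ v, ENNReal.ofReal (v ^ n * Real.exp (s * v)) ∂P.map V =
      ENNReal.ofReal (ftrGMGF γbar m K Δ n s) := by
  have haverage := lintegral_ricianShadowedGMGF_uniformPhase hV.meanPower_nonneg hV.shape_pos
    hV.kFactor_nonneg hV.delta_nonneg hV.delta_le_one hs n
  obtain ⟨hm, V₁, V₂, σ, -, -, hσ, hK, hΔ, hγ, hlaw⟩ := hV
  have hc : 2 * σ ^ 2 = γbar / (1 + K) := by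
    rw [hγ, hK]
    field_simp
    ring
  have hκ : ∀ φ, twoRayKFactor V₁ V₂ σ φ = K * (1 - Δ + 2 * Δ * ((1 + Real.cos φ) / 2)) :=
    fun φ => by rw [hK, hΔ, twoRayKFactor_eq]
  rw [hlaw.map_eq, lintegral_pow_mul_exp_twoRayPowerLaw hm hσ.ne' hs, ← haverage]
  simp only [hc, hκ]

theorem integrable_map_pow_mul_exp (hV : IsFTR V P γbar m K Δ) {s : ℝ} (hs : s ≤ 0) (n : ℕ) :
    Integrable (fun v => v ^ n * Real.exp (s * v)) (P.map V) := by
  refine lintegral_ofReal_ne_top_iff_integrable (by fun_prop) ?_ |>.1 ?_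
  · filter_upwards [hV.ae_map_pos] with v hv
    positivity
  · simp [hV.lintegral_map_pow_mul_exp hs n]

theorem integral_map_pow_mul_exp (hV : IsFTR V P γbar m K Δ) {s : ℝ} (hs : s ≤ 0) (n : ℕ) :
    ∫ v, v ^ n * Real.exp (s * v) ∂P.map V = ftrGMGF γbar m K Δ n s := by
  have hnonneg : 0 ≤ᵐ[P.map V] fun v => v ^ n * Real.exp (s * v) := by
    filter_upwards [hV.ae_map_pos] with v hv
    positivity
  rw [integral_eq_lintegral_of_nonneg_ae hnonneg (by fun_prop), hV.lintegral_map_pow_mul_exp hs,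
    ENNReal.toReal_ofReal (ftrGMGF_nonneg hV.meanPower_nonneg hV.shape_pos hV.kFactor_nonneg
      hV.delta_nonneg hV.delta_le_one hs n)]

end IsFTR

/-- The density of the inverse gamma law with shape `lam` and scale `β`, which is the integrand
in the definition of `inverseGammaMeasure`. -/
def inverseGammaPDFReal (lam β x : ℝ) : ℝ :=
  if 0 < x then β ^ lam / Real.Gamma lam * x ^ (-lam - 1) * Real.exp (-(β / x)) else 0

section InverseGamma

variable {lam β c : ℝ}

theorem inverseGammaMeasure_eq_withDensity (lam β : ℝ) : inverseGammaMeasure lam β =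
    volume.withDensity fun x => ENNReal.ofReal (inverseGammaPDFReal lam β x) := rfl

theorem inverseGammaPDFReal_of_pos {x : ℝ} (hx : 0 < x) (lam β : ℝ) :
    inverseGammaPDFReal lam β x =
      β ^ lam / Real.Gamma lam * x ^ (-lam - 1) * Real.exp (-(β / x)) :=
  if_pos hx

theorem inverseGammaPDFReal_of_nonpos {x : ℝ} (hx : x ≤ 0) (lam β : ℝ) :
    inverseGammaPDFReal lam β x = 0 :=
  if_neg hx.not_gt

theorem measurable_uncurry_inverseGammaPDFReal (lam : ℝ) :
    Measurable (Function.uncurry (inverseGammaPDFReal lam)) :=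
  Measurable.ite (measurableSet_lt measurable_const measurable_snd) (by fun_prop) measurable_const

theorem measurable_inverseGammaPDFReal (lam β : ℝ) : Measurable (inverseGammaPDFReal lam β) :=
  (measurable_uncurry_inverseGammaPDFReal lam).of_uncurry_left

theorem inverseGammaPDFReal_nonneg (hlam : 0 < lam) (hβ : 0 ≤ β) (x : ℝ) :
    0 ≤ inverseGammaPDFReal lam β x := by
  have := Real.Gamma_pos_of_pos hlam
  unfold inverseGammaPDFReal
  split_ifs <;> positivity

theorem setIntegral_rpow_neg_mul_exp_neg_div (hlam : 1 < lam) (hβ : 0 < β) :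
    ∫ x in Set.Ioi 0, x ^ (-lam) * Real.exp (-(β / x)) =
      (1 / β) ^ (lam - 1) * Real.Gamma (lam - 1) := by
  rw [← Real.integral_rpow_mul_exp_neg_mul_Ioi (sub_pos.2 hlam) hβ,
    ← integral_comp_rpow_Ioi (fun t => t ^ (lam - 1 - 1) * Real.exp (-(β * t)))
      (by simp : (-1 : ℝ) ≠ 0)]
  refine setIntegral_congr_fun measurableSet_Ioi fun x (hx : 0 < x) => ?_
  have hpow : x ^ (-1 - 1 : ℝ) * x ^ (-1 * (lam - 1 - 1)) = x ^ (-lam) := by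
    rw [← Real.rpow_add hx]
    ring_nf
  simp only [smul_eq_mul, abs_neg, abs_one, one_mul]
  rw [← Real.rpow_mul hx.le, ← mul_assoc, hpow, Real.rpow_neg_one, div_eq_mul_inv]

theorem integrableOn_rpow_neg_mul_exp_neg_div_iff (hβ : 0 < β) :
    IntegrableOn (fun x => x ^ (-lam) * Real.exp (-(β / x))) (Set.Ioi 0) ↔ 1 < lam := by
  refine ⟨fun hint => ?_, fun hlam => Integrable.of_integral_ne_zero ?_⟩
  · have hpow : IntegrableOn (fun x : ℝ => x ^ (-lam)) (Set.Ioi 1) := by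
      refine ((hint.mono_set (Set.Ioi_subset_Ioi zero_le_one)).const_mul (Real.exp β)).mono'
        (by fun_prop) ((ae_restrict_iff' measurableSet_Ioi).2 (ae_of_all _ fun x hx => ?_))
      have hx0 : 0 < x := one_pos.trans hx
      have hdiv : β / x ≤ β := div_le_self hβ.le (le_of_lt hx)
      rw [Real.norm_of_nonneg (by positivity), mul_left_comm, ← Real.exp_add]
      exact le_mul_of_one_le_right (by positivity) (Real.one_le_exp (by linarith))
    exact neg_lt_neg_iff.1 ((integrableOn_Ioi_rpow_iff one_pos).1 hpow)
  · have := Real.Gamma_pos_of_pos (sub_pos.2 hlam)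
    rw [setIntegral_rpow_neg_mul_exp_neg_div hlam hβ]
    positivity

theorem integrable_inverseGammaPDFReal (hlam : 0 < lam) (hβ : 0 < β) :
    Integrable (inverseGammaPDFReal lam β) := by
  have hint := ((integrableOn_rpow_neg_mul_exp_neg_div_iff (lam := lam + 1) hβ).2
    (by linarith)).const_mul (β ^ lam / Real.Gamma lam)
  refine (integrable_indicator_iff measurableSet_Ioi).2 hint |>.congr (ae_of_all _ fun x => ?_)
  by_cases hx : 0 < x
  · rw [Set.indicator_of_mem (Set.mem_Ioi.2 hx), inverseGammaPDFReal_of_pos hx, neg_add', mul_assoc]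
  · rw [Set.indicator_of_notMem (by simpa using hx), inverseGammaPDFReal_of_nonpos (not_lt.1 hx)]

theorem integral_id_inverseGammaMeasure (hlam : 0 < lam) (hβ : 0 ≤ β) :
    ∫ x, x ∂inverseGammaMeasure lam β =
      β ^ lam / Real.Gamma lam * ∫ x in Set.Ioi 0, x ^ (-lam) * Real.exp (-(β / x)) := by
  rw [inverseGammaMeasure_eq_withDensity, integral_withDensity_eq_integral_toReal_smul
    (measurable_inverseGammaPDFReal lam β).ennreal_ofReal (by simp), ← integral_const_mul]
  simp only [ENNReal.toReal_ofReal (inverseGammaPDFReal_nonneg hlam hβ _), smul_eq_mul]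
  rw [← setIntegral_eq_integral_of_forall_compl_eq_zero (s := Set.Ioi 0)]
  · refine setIntegral_congr_fun measurableSet_Ioi fun x (hx : 0 < x) => ?_
    rw [inverseGammaPDFReal_of_pos hx, Real.rpow_sub_one hx.ne']
    field_simp
  · intro x hx
    rw [inverseGammaPDFReal_of_nonpos (not_lt.1 hx), zero_mul]

theorem integral_id_inverseGammaMeasure_of_one_lt (hlam : 1 < lam) (hβ : 0 < β) :
    ∫ x, x ∂inverseGammaMeasure lam β = β / (lam - 1) := by
  have hlam' : 0 < lam - 1 := sub_pos.2 hlam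
  have hGamma : Real.Gamma (lam - 1) ≠ 0 := (Real.Gamma_pos_of_pos hlam').ne'
  have hrec : Real.Gamma lam = (lam - 1) * Real.Gamma (lam - 1) := by
    rw [← Real.Gamma_add_one hlam'.ne', sub_add_cancel]
  rw [integral_id_inverseGammaMeasure (one_pos.trans hlam) hβ.le,
    setIntegral_rpow_neg_mul_exp_neg_div hlam hβ, hrec, one_div, Real.inv_rpow hβ.le,
    Real.rpow_sub_one hβ.ne']
  field_simp

theorem scale_eq_of_integral_inverseGammaMeasure_eq_one (hlam : 0 < lam) (hβ : 0 < β)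
    (hmean : ∫ x, x ∂inverseGammaMeasure lam β = 1) : β = lam - 1 := by
  have hlam1 : 1 < lam := by
    rw [integral_id_inverseGammaMeasure hlam hβ.le] at hmean
    refine (integrableOn_rpow_neg_mul_exp_neg_div_iff hβ).1 (Integrable.of_integral_ne_zero ?_)
    exact right_ne_zero_of_mul (hmean ▸ one_ne_zero)
  rw [integral_id_inverseGammaMeasure_of_one_lt hlam1 hβ] at hmean
  exact (div_eq_one_iff_eq (sub_pos.2 hlam1).ne').1 hmean

theorem mul_inverseGammaPDFReal_mul_mul (hβ : 0 ≤ β) (hc : 0 < c) (lam x : ℝ) :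
    c * inverseGammaPDFReal lam (c * β) (c * x) = inverseGammaPDFReal lam β x := by
  rcases lt_or_ge 0 x with hx | hx
  · rw [inverseGammaPDFReal_of_pos hx, inverseGammaPDFReal_of_pos (by positivity),
      mul_div_mul_left _ _ hc.ne', Real.mul_rpow hc.le hβ, Real.mul_rpow hc.le hx.le,
      Real.rpow_sub_one hc.ne' (-lam), Real.rpow_neg hc.le]
    field_simp
  · rw [inverseGammaPDFReal_of_nonpos hx,
      inverseGammaPDFReal_of_nonpos (mul_nonpos_of_nonneg_of_nonpos hc.le hx), mul_zero]

theorem map_const_mul_inverseGammaMeasure (hβ : 0 ≤ β) (hc : 0 < c) (lam : ℝ) :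
    (inverseGammaMeasure lam β).map (c * ·) = inverseGammaMeasure lam (c * β) := by
  have hmul : Measurable (c * ·) := measurable_const_mul c
  ext A hA
  rw [Measure.map_apply hmul hA, inverseGammaMeasure_eq_withDensity,
    inverseGammaMeasure_eq_withDensity, withDensity_apply _ (hmul hA), withDensity_apply _ hA]
  conv_rhs =>
    rw [← Real.smul_map_volume_mul_left hc.ne', Measure.restrict_smul, lintegral_smul_measure,
      setLIntegral_map hA (measurable_inverseGammaPDFReal lam _).ennreal_ofReal hmul,
      abs_of_pos hc, smul_eq_mul, ← lintegral_const_mul' _ _ ENNReal.ofReal_ne_top]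
  simp only [← ENNReal.ofReal_mul hc.le, mul_inverseGammaPDFReal_mul_mul hβ hc]

end InverseGamma

/-- The probability that a Poisson variable of mean `t` is less than `N`. -/
def poissonPartialSum (N : ℕ) (t : ℝ) : ℝ :=
  ∑ n ∈ Finset.range N, t ^ n / n.factorial * Real.exp (-t)

section InverseGammaIntegerShape

variable {β : ℝ}

theorem hasDerivAt_poissonPartialSum_add_one (N : ℕ) (t : ℝ) :
    HasDerivAt (poissonPartialSum (N + 1)) (-(t ^ N / N.factorial * Real.exp (-t))) t := by
  have hexp : HasDerivAt (fun t => Real.exp (-t)) (-Real.exp (-t)) t := by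
    simpa using (hasDerivAt_neg t).exp
  induction N with
  | zero =>
    have hone : poissonPartialSum (0 + 1) = fun t => Real.exp (-t) :=
      funext fun t => by simp [poissonPartialSum]
    simpa [hone] using hexp
  | succ N ih =>
    have hsucc : poissonPartialSum (N + 1 + 1) = fun t => poissonPartialSum (N + 1) t +
        t ^ (N + 1) / (N + 1).factorial * Real.exp (-t) :=
      funext fun t => Finset.sum_range_succ _ _
    rw [hsucc]
    refine (ih.add (((hasDerivAt_pow (N + 1) t).div_const _).mul hexp)).congr_deriv ?_
    rw [Nat.factorial_succ]
    push_cast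
    field_simp
    ring

theorem tendsto_poissonPartialSum_atTop (N : ℕ) :
    Filter.Tendsto (poissonPartialSum N) Filter.atTop (nhds 0) := by
  rw [← Finset.sum_const_zero (s := Finset.range N)]
  refine tendsto_finsetSum _ fun n _ => ?_
  simpa only [div_mul_eq_mul_div, zero_div] using
    (Real.tendsto_pow_mul_exp_neg_atTop_nhds_zero n).div_const (n.factorial : ℝ)

theorem hasDerivAt_poissonPartialSum_div {x : ℝ} (hx : 0 < x) (N : ℕ) (β : ℝ) :
    HasDerivAt (fun x => poissonPartialSum (N + 1) (β / x))
      (inverseGammaPDFReal (N + 1 : ℕ) β x) x := by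
  have hinv : HasDerivAt (fun x => β / x) (-(β / x ^ 2)) x := by
    simpa [div_eq_mul_inv] using (hasDerivAt_inv hx.ne').const_mul β
  refine ((hasDerivAt_poissonPartialSum_add_one N (β / x)).comp x hinv).congr_deriv ?_
  have hpow : x ^ (-((N + 1 : ℕ) : ℝ) - 1) = (x ^ (N + 2))⁻¹ := by
    rw [← Real.rpow_natCast, ← Real.rpow_neg hx.le]
    push_cast
    ring_nf
  rw [inverseGammaPDFReal_of_pos hx, hpow, Real.rpow_natCast, div_pow, Nat.cast_succ,
    Real.Gamma_nat_eq_factorial]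
  field_simp
  ring

theorem inverseGammaMeasure_Iic {y : ℝ} (N : ℕ) (hβ : 0 < β) (hy : 0 < y) :
    inverseGammaMeasure (N + 1 : ℕ) β (Set.Iic y) =
      ENNReal.ofReal (poissonPartialSum (N + 1) (β / y)) := by
  have hN : (0 : ℝ) < (N + 1 : ℕ) := by positivity
  have hint := integrable_inverseGammaPDFReal hN hβ
  have hzero : Filter.Tendsto (fun x => poissonPartialSum (N + 1) (β / x))
      (nhdsWithin 0 (Set.Ioi 0)) (nhds 0) :=
    (tendsto_poissonPartialSum_atTop (N + 1)).comp (tendsto_inv_nhdsGT_zero.const_mul_atTop hβ)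
  have hFTC := intervalIntegral.integral_eq_sub_of_hasDerivAt_of_tendsto hy
    (fun x hx => hasDerivAt_poissonPartialSum_div hx.1 N β) hint.intervalIntegrable hzero
    ((hasDerivAt_poissonPartialSum_div hy N β).continuousAt.tendsto.mono_left nhdsWithin_le_nhds)
  rw [inverseGammaMeasure_eq_withDensity, withDensity_apply _ measurableSet_Iic,
    ← ofReal_integral_eq_lintegral_ofReal hint.integrableOn
      (ae_of_all _ (inverseGammaPDFReal_nonneg hN hβ.le)),
    setIntegral_eq_of_subset_of_forall_sdiff_eq_zero (s := Set.Ioc 0 y) measurableSet_Iic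
      Set.Ioc_subset_Iic_self, ← intervalIntegral.integral_of_le hy.le, hFTC, sub_zero]
  exact fun x hx => inverseGammaPDFReal_of_nonpos (not_lt.1 fun h => hx.2 ⟨h, hx.1⟩) _ _

end InverseGammaIntegerShape

section GMGF

variable {Ω : Type*} [MeasurableSpace Ω] {P : Measure Ω} {V : Ω → ℝ} {n s : ℝ}

theorem gmgfIntegrand_eq_rnDeriv_smul (V : Ω → ℝ) (P : Measure Ω) (n s : ℝ) :
    gmgfIntegrand V P n s =
      fun v => ((P.map V).rnDeriv volume v).toReal • (v ^ n * Real.exp (v * s)) :=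
  funext fun _ => mul_comm _ _

theorem gmgf_eq_integral_map [IsFiniteMeasure P] (hac : P.map V ≪ volume)
    (hpos : ∀ᵐ v ∂P.map V, 0 < v) (n s : ℝ) :
    gmgf V P n s = ∫ v, v ^ n * Real.exp (v * s) ∂P.map V := by
  rw [gmgf, gmgfIntegrand_eq_rnDeriv_smul, setIntegral_rnDeriv_smul hac measurableSet_Ioi,
    Measure.restrict_eq_self_of_ae_mem (s := Set.Ioi 0) hpos]

theorem integrableOn_gmgfIntegrand [IsFiniteMeasure P] (hac : P.map V ≪ volume)
    (hint : Integrable (fun v => v ^ n * Real.exp (v * s)) (P.map V)) :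
    IntegrableOn (gmgfIntegrand V P n s) (Set.Ioi 0) := by
  rw [gmgfIntegrand_eq_rnDeriv_smul]
  exact ((integrable_rnDeriv_smul_iff hac).2 hint).integrableOn

theorem Iio_zero_subset_interior_integrableExpSet {μ : Measure ℝ} [IsFiniteMeasure μ]
    (hnonneg : ∀ᵐ v ∂μ, 0 ≤ v) : Set.Iio 0 ⊆ interior (integrableExpSet id μ) := by
  refine interior_maximal (fun s (hs : s < 0) => ?_) isOpen_Iio
  refine Integrable.of_bound (by fun_prop) 1 ?_
  filter_upwards [hnonneg] with v hv
  simpa using mul_nonpos_of_nonpos_of_nonneg hs.le hv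

theorem integrable_rpow_mul_exp [IsFiniteMeasure P] (hpos : ∀ᵐ v ∂P.map V, 0 < v)
    (hn : 0 ≤ n) (hs : s < 0) : Integrable (fun v => v ^ n * Real.exp (v * s)) (P.map V) := by
  simpa only [mul_comm s, id] using integrable_rpow_mul_exp_of_mem_interior_integrableExpSet
    (Iio_zero_subset_interior_integrableExpSet (hpos.mono fun _ => le_of_lt) hs) hn

end GMGF

/-- The density of `Zbar * G * V` when `G` is inverse gamma with shape `lam` and scale `β` and
independent of `V`. It is `compositePDF` for `β = lam - 1`, the scale for which `G` has mean one. -/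
def inverseGammaProductPDF {Ω : Type*} [MeasurableSpace Ω] (V : Ω → ℝ) (P : Measure Ω)
    (Zbar lam β z : ℝ) : ℝ :=
  if 0 < z then
    Zbar ^ lam * β ^ lam / (z ^ (lam + 1) * Real.Gamma lam) * gmgf V P lam (-β * Zbar / z)
  else 0

section InverseGammaProduct

variable {Zbar lam β v z : ℝ}

theorem inverseGammaPDFReal_mul_mul (hZbar : 0 ≤ Zbar) (hβ : 0 ≤ β) (hv : 0 ≤ v) (hz : 0 < z) :
    inverseGammaPDFReal lam (Zbar * v * β) z =
      Zbar ^ lam * β ^ lam / (z ^ (lam + 1) * Real.Gamma lam) *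
        (v ^ lam * Real.exp (v * (-β * Zbar / z))) := by
  rw [inverseGammaPDFReal_of_pos hz, Real.mul_rpow (by positivity) hβ, Real.mul_rpow hZbar hv,
    ← neg_add', Real.rpow_neg hz.le,
    show -(Zbar * v * β / z) = v * (-β * Zbar / z) by ring]
  ring

theorem poissonPartialSum_mul_mul_div (N : ℕ) (Zbar β v z : ℝ) :
    poissonPartialSum N (Zbar * v * β / z) =
      ∑ n ∈ Finset.range N, Zbar ^ n * β ^ n / (z ^ n * Real.Gamma (n + 1)) *
        (v ^ (n : ℝ) * Real.exp (v * (-β * Zbar / z))) := by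
  refine Finset.sum_congr rfl fun n _ => ?_
  rw [Real.Gamma_nat_eq_factorial, Real.rpow_natCast, div_pow, mul_pow, mul_pow,
    show -(Zbar * v * β / z) = v * (-β * Zbar / z) by ring]
  ring

theorem neg_scale_mul_div_neg (hZbar : 0 < Zbar) (hβ : 0 < β) (hz : 0 < z) :
    -β * Zbar / z < 0 :=
  div_neg_of_neg_of_pos (mul_neg_of_neg_of_pos (neg_lt_zero.2 hβ) hZbar) hz

variable {Ω : Type*} [MeasurableSpace Ω] {P : Measure Ω} [IsProbabilityMeasure P] {G V : Ω → ℝ}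

theorem map_inverseGamma_product_apply (hG : HasLaw G (inverseGammaMeasure lam β) P)
    (hV : AEMeasurable V P) (hGV : IndepFun G V P) (hpos : ∀ᵐ v ∂P.map V, 0 < v)
    (hZbar : 0 < Zbar) (hβ : 0 ≤ β) {A : Set ℝ} (hA : MeasurableSet A) :
    P.map (fun ω => Zbar * G ω * V ω) A =
      ∫⁻ v, inverseGammaMeasure lam (Zbar * v * β) A ∂P.map V := by
  have := Measure.isProbabilityMeasure_map (μ := P) hG.aemeasurable
  have := Measure.isProbabilityMeasure_map (μ := P) hV
  have hmeas : Measurable fun p : ℝ × ℝ => Zbar * p.1 * p.2 := by fun_prop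
  have hmap : P.map (fun ω => Zbar * G ω * V ω) =
      ((P.map G).prod (P.map V)).map fun p => Zbar * p.1 * p.2 := by
    rw [← (indepFun_iff_map_prod_eq_prod_map_map hG.aemeasurable hV).1 hGV,
      AEMeasurable.map_map_of_aemeasurable hmeas.aemeasurable (hG.aemeasurable.prodMk hV)]
    rfl
  rw [hmap, Measure.map_apply hmeas hA, Measure.prod_apply_symm (hmeas hA)]
  refine lintegral_congr_ae ?_
  filter_upwards [hpos] with v hv
  rw [hG.map_eq, ← map_const_mul_inverseGammaMeasure hβ (mul_pos hZbar hv),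
    Measure.map_apply (measurable_const_mul _) hA]
  simp only [Set.preimage, Set.mem_ofPred_eq, mul_right_comm Zbar _ v]

theorem lintegral_inverseGammaPDFReal (hac : P.map V ≪ volume) (hpos : ∀ᵐ v ∂P.map V, 0 < v)
    (hZbar : 0 < Zbar) (hlam : 0 < lam) (hβ : 0 < β) (z : ℝ) :
    ∫⁻ v, ENNReal.ofReal (inverseGammaPDFReal lam (Zbar * v * β) z) ∂P.map V =
      ENNReal.ofReal (inverseGammaProductPDF V P Zbar lam β z) := by
  rcases lt_or_ge 0 z with hz | hz
  · have := Real.Gamma_pos_of_pos hlam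
    have hint := integrable_rpow_mul_exp hpos hlam.le (neg_scale_mul_div_neg hZbar hβ hz)
    rw [inverseGammaProductPDF, if_pos hz, gmgf_eq_integral_map hac hpos, ← integral_const_mul,
      ofReal_integral_eq_lintegral_ofReal (hint.const_mul _)]
    · refine lintegral_congr_ae ?_
      filter_upwards [hpos] with v hv
      rw [inverseGammaPDFReal_mul_mul hZbar.le hβ.le hv.le hz]
    · filter_upwards [hpos] with v hv
      positivity
  · simp [inverseGammaProductPDF, inverseGammaPDFReal_of_nonpos hz, hz.not_gt]

theorem hasLaw_inverseGamma_product (hG : HasLaw G (inverseGammaMeasure lam β) P)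
    (hV : AEMeasurable V P) (hGV : IndepFun G V P) (hac : P.map V ≪ volume)
    (hpos : ∀ᵐ v ∂P.map V, 0 < v) (hZbar : 0 < Zbar) (hlam : 0 < lam) (hβ : 0 < β) :
    HasLaw (fun ω => Zbar * G ω * V ω)
      (volume.withDensity fun z => ENNReal.ofReal (inverseGammaProductPDF V P Zbar lam β z)) P := by
  have hmeas : Measurable fun p : ℝ × ℝ =>
      ENNReal.ofReal (inverseGammaPDFReal lam (Zbar * p.1 * β) p.2) :=
    ((measurable_uncurry_inverseGammaPDFReal lam).comp
      (by fun_prop : Measurable fun p : ℝ × ℝ => (Zbar * p.1 * β, p.2))).ennreal_ofReal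
  refine ⟨(hG.aemeasurable.const_mul Zbar).mul hV, Measure.ext fun A hA => ?_⟩
  simp only [map_inverseGamma_product_apply hG hV hGV hpos hZbar hβ.le hA,
    inverseGammaMeasure_eq_withDensity, withDensity_apply _ hA]
  rw [lintegral_lintegral_swap hmeas.aemeasurable]
  simp only [lintegral_inverseGammaPDFReal hac hpos hZbar hlam hβ]

theorem lintegral_poissonPartialSum (hac : P.map V ≪ volume) (hpos : ∀ᵐ v ∂P.map V, 0 < v)
    (hZbar : 0 < Zbar) (hβ : 0 < β) (hz : 0 < z) (N : ℕ) :
    ∫⁻ v, ENNReal.ofReal (poissonPartialSum N (Zbar * v * β / z)) ∂P.map V =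
      ENNReal.ofReal (∑ n ∈ Finset.range N, Zbar ^ n * β ^ n / (z ^ n * Real.Gamma (n + 1)) *
        gmgf V P n (-β * Zbar / z)) := by
  have hint (n : ℕ) : Integrable (fun v => Zbar ^ n * β ^ n / (z ^ n * Real.Gamma (n + 1)) *
      (v ^ (n : ℝ) * Real.exp (v * (-β * Zbar / z)))) (P.map V) :=
    (integrable_rpow_mul_exp hpos n.cast_nonneg (neg_scale_mul_div_neg hZbar hβ hz)).const_mul _
  simp only [gmgf_eq_integral_map hac hpos, ← integral_const_mul]
  rw [← integral_finsetSum _ fun n _ => hint n,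
    ofReal_integral_eq_lintegral_ofReal (integrable_finsetSum _ fun n _ => hint n)]
  · simp only [poissonPartialSum_mul_mul_div]
  · filter_upwards [hpos] with v hv
    exact Finset.sum_nonneg fun n _ => by positivity

theorem cdf_inverseGamma_product {N : ℕ} (hG : HasLaw G (inverseGammaMeasure (N + 1 : ℕ) β) P)
    (hV : AEMeasurable V P) (hGV : IndepFun G V P) (hac : P.map V ≪ volume)
    (hpos : ∀ᵐ v ∂P.map V, 0 < v) (hZbar : 0 < Zbar) (hβ : 0 < β) (hz : 0 < z) :
    cdf (P.map fun ω => Zbar * G ω * V ω) z =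
      ∑ n ∈ Finset.range (N + 1), Zbar ^ n * β ^ n / (z ^ n * Real.Gamma (n + 1)) *
        gmgf V P n (-β * Zbar / z) := by
  have : IsProbabilityMeasure (P.map fun ω => Zbar * G ω * V ω) :=
    Measure.isProbabilityMeasure_map ((hG.aemeasurable.const_mul Zbar).mul hV)
  have hcond : ∀ᵐ v ∂P.map V, inverseGammaMeasure (N + 1 : ℕ) (Zbar * v * β) (Set.Iic z) =
      ENNReal.ofReal (poissonPartialSum (N + 1) (Zbar * v * β / z)) := by
    filter_upwards [hpos] with v hv
    exact inverseGammaMeasure_Iic N (by positivity) hz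
  rw [cdf_eq_real, Measure.real,
    map_inverseGamma_product_apply hG hV hGV hpos hZbar hβ.le measurableSet_Iic,
    lintegral_congr_ae hcond, lintegral_poissonPartialSum hac hpos hZbar hβ hz,
    ENNReal.toReal_ofReal]
  refine Finset.sum_nonneg fun n _ => ?_
  rw [gmgf_eq_integral_map hac hpos]
  refine mul_nonneg (by positivity) (integral_nonneg_of_ae ?_)
  filter_upwards [hpos] with v hv
  positivity

end InverseGammaProduct

namespace IsFTR

variable {Ω : Type*} [MeasurableSpace Ω] {P : Measure Ω} [IsFiniteMeasure P] {V : Ω → ℝ}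
  {γbar m K Δ s : ℝ}

theorem integrableOn_gmgfIntegrand (hV : IsFTR V P γbar m K Δ) (hs : s ≤ 0) (n : ℕ) :
    IntegrableOn (gmgfIntegrand V P n s) (Set.Ioi 0) := by
  refine _root_.integrableOn_gmgfIntegrand hV.map_absolutelyContinuous ?_
  simpa only [Real.rpow_natCast, mul_comm s] using hV.integrable_map_pow_mul_exp hs n

theorem gmgf_eq_ftrGMGF (hV : IsFTR V P γbar m K Δ) (hs : s ≤ 0) (n : ℕ) :
    gmgf V P n s = ftrGMGF γbar m K Δ n s := by
  rw [gmgf_eq_integral_map hV.map_absolutelyContinuous hV.ae_map_pos,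
    ← hV.integral_map_pow_mul_exp hs]
  simp only [Real.rpow_natCast, mul_comm s]

end IsFTR

end

theorem mainTheorem4_general {Ω : Type*} [MeasurableSpace Ω] (P : Measure Ω)
    [IsProbabilityMeasure P] (G V : Ω → ℝ) (Zbar lam β γbar m K Δ : ℝ) (hZbar : 0 < Zbar)
    (hlam : 0 < lam) (hβ : 0 < β) (hG : HasLaw G (inverseGammaMeasure lam β) P)
    (hV : IsFTR V P γbar m K Δ) (hGV : IndepFun G V P) :
    (∀ z : ℝ, 0 < z →
      IntegrableOn (gmgfIntegrand V P lam (-β * Zbar / z)) (Set.Ioi 0)) ∧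
    HasLaw (fun ω => Zbar * G ω * V ω)
      (volume.withDensity fun z => ENNReal.ofReal (inverseGammaProductPDF V P Zbar lam β z)) P ∧
    (∀ N : ℕ, lam = N → ∀ z : ℝ, 0 < z →
      cdf (P.map fun ω => Zbar * G ω * V ω) z =
        ∑ n ∈ Finset.range N, Zbar ^ n * β ^ n / (z ^ n * Real.Gamma (n + 1)) *
          gmgf V P n (-β * Zbar / z)) ∧
    (∀ (n : ℕ) (s : ℝ), s ≤ 0 →
      IntegrableOn (gmgfIntegrand V P n s) (Set.Ioi 0) ∧ gmgf V P n s = ftrGMGF γbar m K Δ n s) ∧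
    (∀ N : ℕ, lam = N → ∀ z : ℝ, 0 < z →
      inverseGammaProductPDF V P Zbar lam β z =
        Zbar ^ lam * β ^ lam / (z ^ (lam + 1) * Real.Gamma lam) *
          ftrGMGF γbar m K Δ N (-β * Zbar / z) ∧
      cdf (P.map fun ω => Zbar * G ω * V ω) z =
        ∑ n ∈ Finset.range N, Zbar ^ n * β ^ n / (z ^ n * Real.Gamma (n + 1)) *
          ftrGMGF γbar m K Δ n (-β * Zbar / z)) := by
  have hac := hV.map_absolutelyContinuous
  have hpos := hV.ae_map_pos
  have hs (z : ℝ) (hz : 0 < z) : -β * Zbar / z < 0 := neg_scale_mul_div_neg hZbar hβ hz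
  have hcdf (N : ℕ) (hN : lam = N) (z : ℝ) (hz : 0 < z) :
      cdf (P.map fun ω => Zbar * G ω * V ω) z =
        ∑ n ∈ Finset.range N, Zbar ^ n * β ^ n / (z ^ n * Real.Gamma (n + 1)) *
          gmgf V P n (-β * Zbar / z) := by
    subst hN
    obtain ⟨M, rfl⟩ := Nat.exists_eq_succ_of_ne_zero (Nat.cast_pos.1 hlam).ne'
    exact cdf_inverseGamma_product hG hV.aemeasurable hGV hac hpos hZbar hβ hz
  refine ⟨fun z hz =>
      integrableOn_gmgfIntegrand hac (integrable_rpow_mul_exp hpos hlam.le (hs z hz)),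
    hasLaw_inverseGamma_product hG hV.aemeasurable hGV hac hpos hZbar hlam hβ, hcdf,
    fun n s hs => ⟨hV.integrableOn_gmgfIntegrand hs n, hV.gmgf_eq_ftrGMGF hs n⟩,
    fun N hN z hz => ⟨?_, ?_⟩⟩
  · rw [inverseGammaProductPDF, if_pos hz, ← hV.gmgf_eq_ftrGMGF (hs z hz).le, hN]
  · simp only [hcdf N hN z hz, hV.gmgf_eq_ftrGMGF (hs z hz).le]

theorem mainTheorem4 {Ω : Type*} [MeasurableSpace Ω] (P : Measure Ω) [IsProbabilityMeasure P]
    (G V : Ω → ℝ) (Zbar lam β m K Δ : ℝ) (hZbar : 0 < Zbar)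
    (hlam : 0 < lam) (hβ : 0 < β)
    (hG : HasLaw G (inverseGammaMeasure lam β) P) (hGmean : ∫ ω, G ω ∂P = 1)
    (hV : IsFTR V P 1 m K Δ)
    (hGV : IndepFun G V P) :
    -- the density of `Z = Zbar * G * V`, for every real shape parameter
    (∀ z : ℝ, 0 < z →
      IntegrableOn (gmgfIntegrand V P lam ((1 - lam) * Zbar / z)) (Set.Ioi 0)) ∧
    HasLaw (fun ω => Zbar * G ω * V ω)
      (volume.withDensity fun z => ENNReal.ofReal (compositePDF V P Zbar lam z)) P ∧
    -- the distribution function of `Z`, for integer shape parameter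
    (∀ N : ℕ, lam = N → ∀ z : ℝ, 0 < z →
      cdf (P.map fun ω => Zbar * G ω * V ω) z =
        ∑ n ∈ Finset.range N, Zbar ^ n * (lam - 1) ^ n / (z ^ n * Real.Gamma (n + 1)) *
          gmgf V P n ((1 - lam) * Zbar / z)) ∧
    -- the closed form of the generalized moment generating function of `V`
    (∀ (n : ℕ) (s : ℝ), s ≤ 0 →
      IntegrableOn (gmgfIntegrand V P n s) (Set.Ioi 0) ∧ gmgf V P n s = ftrGMGF 1 m K Δ n s) ∧
    -- the resulting closed forms of density and distribution function, for integer shape parameter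
    (∀ N : ℕ, lam = N → ∀ z : ℝ, 0 < z →
      compositePDF V P Zbar lam z =
        Zbar ^ lam * (lam - 1) ^ lam / (z ^ (lam + 1) * Real.Gamma lam) *
          ftrGMGF 1 m K Δ N ((1 - lam) * Zbar / z) ∧
      cdf (P.map fun ω => Zbar * G ω * V ω) z =
        ∑ n ∈ Finset.range N, Zbar ^ n * (lam - 1) ^ n / (z ^ n * Real.Gamma (n + 1)) *
          ftrGMGF 1 m K Δ n ((1 - lam) * Zbar / z)) := by
  obtain rfl := scale_eq_of_integral_inverseGammaMeasure_eq_one hlam hβ (hG.integral_eq ▸ hGmean)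
  simpa only [inverseGammaProductPDF, compositePDF, neg_sub] using
    mainTheorem4_general P G V Zbar lam (lam - 1) 1 m K Δ hZbar hlam hβ hG hV hGV
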